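/- Let $q$ be a power of an odd prime $p$, let $l\neq p$ be a prime and let $\psi:\mathbb{F}_q\to\overline{\mathbb{Q}}_l^{*}$ be a non-trivial character. Let $V$ be a four-dimensional symplectic space over $\mathbb{F}_q$ with complementary Lagrangian subspaces $L,L'$, and let $E=\mathbb{F}_{q^2}$ with the symmetric bilinear form $\langle x,y\rangle_E=\frac12(xy^q+x^qy)$. Let $W$ be the Weil representation of $Sp(V\otimes E)$ attached to $\psi$, realized on the $\overline{\mathbb{Q}}_l$-valued functions on $L'\otimes E$ and viewed as a representation of $Sp(V)\times O(E)$, and let $W_1^-\subset W$ be the representation of $Sp(V)$ on the vectors that are fixed by $SO(E)$ and on which the conjugation $x\mapsto x^q$ in $O(E)$ acts by $-1$. Let $P_1\subset Sp(V)$ be the stabilizer of $L$, let $U_1\subset P_1$ be the subgroup of elements acting as the identity on $L$, and let $M_1$ be the stabilizer of the pair $(L,L')$. (i) The restriction $W_1^-|_{P_1}$ is irreducible. (ii) There are vectors in $L'\otimes E$ that are indecomposable, i.e. not of the form $x\otimes e$ with $x\in L'$, $e\in E$. For every such vector $v$, let $O\subset M_1$ be the stabilizer of the orbit $O(E)\cdot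 v$. Then there is an isomorphism $\iota:O(E)\to O$ with $(\iota(t)\otimes t)v=v$ for all $t\in O(E)$, and there is a character $\phi':OU_1\to\overline{\mathbb{Q}}_l^{*}$ with $$\phi'(\iota(t)g)=\epsilon(t)\,\phi(g)\qquad(t\in O(E),\ g\in U_1),$$ where $\epsilon$ is the sign character of $O(E)$ (equal to $1$ on $SO(E)$ and to $-1$ elsewhere) and $\phi(g)=\psi\left(\frac12\langle (g\otimes 1-1)v,v\rangle_{V\otimes E}\right)$, such that $$W_1^-|_{P_1}\cong \mathrm{Ind}_{OU_1}^{P_1}(\phi').$$ (iii) In particular, $W_1^-$ is an irreducible representation of $Sp(V)$. -/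

import Mathlib

open scoped TensorProduct

noncomputable section

set_option linter.unusedSectionVars false

/-- The group of linear isometries of a bilinear form. -/
def isometryGroup {F X : Type*} [Field F] [AddCommGroup X] [Module F X]
    (B : LinearMap.BilinForm F X) : Subgroup (X ≃ₗ[F] X) where
  carrier := {g | ∀ x y, B (g x) (g y) = B x y}
  mul_mem' := by
    intro a b ha hb x y
    simp only [LinearEquiv.mul_apply]
    rw [ha, hb]
  one_mem' := fun _ _ => rfl
  inv_mem' := by
    intro a ha x y
    have := ha (a⁻¹ x) (a⁻¹ y)
    rw [← LinearEquiv.mul_apply, ← LinearEquiv.mul_apply, mul_inv_cancel] at this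
    exact this.symm

/-- A symplectic space together with a pair of complementary Lagrangian subspaces. -/
structure PolarizedSymplecticSpace (F X : Type*) [Field F] [AddCommGroup X] [Module F X] where
  form : LinearMap.BilinForm F X
  isAlt : form.IsAlt
  nondegenerate : form.Nondegenerate
  L : Submodule F X
  L' : Submodule F X
  lagrangian : form.orthogonal L = L
  lagrangian' : form.orthogonal L' = L'
  isCompl : IsCompl L L'

namespace PolarizedSymplecticSpace

section Weil

variable {F X K : Type*} [Field F] [AddCommGroup X] [Module F X] [Field K]
  (S : PolarizedSymplecticSpace F X) (ψ : AddChar F K)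

/-- The symplectic group. -/
abbrev Sp : Subgroup (X ≃ₗ[F] X) := isometryGroup S.form

/-- The component in `L` along `X = L ⊕ L'`. -/
def fst : X →ₗ[F] S.L := S.L.projectionOnto S.L' S.isCompl

/-- The component in `L'` along `X = L ⊕ L'`. -/
def snd : X →ₗ[F] S.L' := S.L'.projectionOnto S.L S.isCompl.symm

/-- The Schrödinger model of the representation of the Heisenberg group `X × F`, with group law
`(x, z) (y, w) = (x + y, z + w + ⟨x, y⟩ / 2)`, with central character `ψ`, on the functions on
`L'`: the operator attached to `(x, 0)`. For `a ∈ L` it is multiplication by `v ↦ ψ ⟨a, v⟩`, for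
`b ∈ L'` it is translation by `b`. -/
def schrodinger (x : X) : (S.L' → K) →ₗ[K] (S.L' → K) where
  toFun f v := ψ (S.form (S.fst x) v - 2⁻¹ * S.form (S.fst x) (S.snd x)) * f (v - S.snd x)
  map_add' f g := by ext v; simp [mul_add]
  map_smul' c f := by ext v; simp [mul_left_comm]

lemma schrodinger_apply (x : X) (f : S.L' → K) (v : S.L') : S.schrodinger ψ x f v =
    ψ (S.form (S.fst x) v - 2⁻¹ * S.form (S.fst x) (S.snd x)) * f (v - S.snd x) := rfl

/-- A Weil representation attached to `ψ`: a representation `ω` of the symplectic group on the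
space of the Schrödinger representation `ρ`, such that `ω(g) ρ(x) ω(g)⁻¹ = ρ(g x)`. -/
def IsWeil (ω : Representation K S.Sp (S.L' → K)) : Prop :=
  ∀ (g : S.Sp) (x : X), ω g ∘ₗ S.schrodinger ψ x = S.schrodinger ψ (g.1 x) ∘ₗ ω g

lemma fst_add_snd (x : X) : (S.fst x : X) + S.snd x = x := by
  simpa [fst, snd] using Submodule.projection_add_projection_eq_self S.isCompl x

lemma form_LL (a b : S.L) : S.form a b = 0 := by
  have : (b : X) ∈ S.form.orthogonal S.L := S.lagrangian.symm ▸ b.2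
  exact this a a.2

lemma form_LL' (a b : S.L') : S.form a b = 0 := by
  have : (b : X) ∈ S.form.orthogonal S.L' := S.lagrangian'.symm ▸ b.2
  exact this a a.2

lemma form_swap (x y : X) : S.form x y = - S.form y x := (LinearMap.IsAlt.neg S.isAlt y x).symm

lemma form_eq (x y : X) : S.form x y =
    S.form (S.fst x) (S.snd y) - S.form (S.fst y) (S.snd x) := by
  conv_lhs => rw [← S.fst_add_snd x, ← S.fst_add_snd y]
  simp only [map_add, LinearMap.add_apply, form_LL, form_LL']
  rw [S.form_swap (S.snd x)]
  ring

/-- The Heisenberg commutation relations. -/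
lemma schrodinger_mul (h2 : (2 : F) ≠ 0) (x y : X) :
    S.schrodinger ψ x ∘ₗ S.schrodinger ψ y =
      ψ (2⁻¹ * S.form x y) • S.schrodinger ψ (x + y) := by
  ext f v
  simp only [LinearMap.comp_apply, schrodinger_apply, LinearMap.smul_apply, Pi.smul_apply,
    smul_eq_mul, map_add]
  rw [← mul_assoc, ← mul_assoc, ← AddChar.map_add_eq_mul, ← AddChar.map_add_eq_mul,
    sub_sub, S.form_eq x y]
  congr 2
  simp only [map_add, LinearMap.add_apply, Submodule.coe_add, Submodule.coe_sub, map_sub]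
  field_simp
  ring

lemma schrodinger_zero : S.schrodinger ψ (0 : X) = LinearMap.id := by
  ext f v
  simp [schrodinger_apply]

lemma exists_form_ne {w : S.L'} (hw : w ≠ 0) : ∃ a : S.L, S.form a w ≠ 0 := by
  by_contra! h
  apply hw
  have : (w : X) ∈ S.form.orthogonal S.L := fun a ha => h ⟨a, ha⟩
  rw [S.lagrangian] at this
  have := S.isCompl.disjoint.le_bot (show (w : X) ∈ S.L ⊓ S.L' from ⟨this, w.2⟩)
  simpa using this

lemma exists_form_ne' {a : S.L} (ha : a ≠ 0) : ∃ w : S.L', S.form a w ≠ 0 := by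
  by_contra! h
  apply ha
  have : (a : X) ∈ S.form.orthogonal S.L' := fun w hw => by
    have := h ⟨w, hw⟩
    rw [S.form_swap, neg_eq_zero] at this
    exact this
  rw [S.lagrangian'] at this
  have := S.isCompl.disjoint.le_bot (show (a : X) ∈ S.L ⊓ S.L' from ⟨a.2, this⟩)
  simpa using this

lemma sum_char {Y : Type*} [AddCommGroup Y] [Module F Y] [Fintype Y] (hψ : ψ ≠ 1)
    (l : Y →ₗ[F] F) (hl : ∃ a, l a ≠ 0) : ∑ a, ψ (l a) = 0 := by
  obtain ⟨a, ha⟩ := hl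
  obtain ⟨t, ht⟩ := (AddChar.ne_one_iff).1 hψ
  have h1 : ψ.compAddMonoidHom l.toAddMonoidHom ≠ 1 := by
    rw [AddChar.ne_one_iff]
    refine ⟨(t / l a) • a, ?_⟩
    simpa [ha] using ht
  exact AddChar.sum_eq_zero_of_ne_one h1

lemma sum_L [Fintype S.L] [DecidableEq S.L'] (hψ : ψ ≠ 1) (w : S.L') :
    ∑ a : S.L, ψ (S.form a w) = if w = 0 then (Fintype.card S.L : K) else 0 := by
  split_ifs with h
  · simp [h]
  · exact sum_char ψ hψ ((S.form.flip w) ∘ₗ S.L.subtype) (S.exists_form_ne h)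

lemma sum_L' [Fintype S.L'] (hψ : ψ ≠ 1) (a : S.L) (ha : a ≠ 0) :
    ∑ v : S.L', ψ (S.form a v) = 0 :=
  sum_char ψ hψ ((S.form a) ∘ₗ S.L'.subtype) (S.exists_form_ne' ha)

@[simp] lemma fst_L (a : S.L) : S.fst (a : X) = a := by simp [fst]
@[simp] lemma snd_L (a : S.L) : S.snd (a : X) = 0 := by simp [snd]
@[simp] lemma fst_L' (a : S.L') : S.fst (a : X) = 0 := by simp [fst]
@[simp] lemma snd_L' (a : S.L') : S.snd (a : X) = a := by simp [snd]

lemma schrodinger_L (a : S.L) (f : S.L' → K) (v : S.L') :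
    S.schrodinger ψ a f v = ψ (S.form a v) * f v := by
  simp [schrodinger_apply]

lemma schrodinger_L' (b : S.L') (f : S.L' → K) (v : S.L') :
    S.schrodinger ψ b f v = f (v - b) := by
  simp [schrodinger_apply]

lemma schrodinger_single [DecidableEq S.L'] (v : S.L') :
    S.schrodinger ψ v (Pi.single 0 1) = Pi.single v 1 := by
  ext w
  simp [schrodinger_L', Pi.single_apply, sub_eq_zero]

lemma sum_schrodinger [Fintype S.L] [DecidableEq S.L'] (hψ : ψ ≠ 1) (f : S.L' → K) (v : S.L') :
    ∑ a : S.L, ψ (-S.form a v) • S.schrodinger ψ a f =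
      ((Fintype.card S.L : K) * f v) • Pi.single v 1 := by
  ext w
  simp only [Finset.sum_apply, Pi.smul_apply, schrodinger_L, smul_eq_mul, ← mul_assoc,
    ← AddChar.map_add_eq_mul]
  rw [← Finset.sum_mul]
  have : ∀ a : S.L, -S.form a v + S.form a w = S.form a ((w - v : S.L') : X) := by
    intro a; simp; ring
  simp only [this, S.sum_L ψ hψ, sub_eq_zero, Pi.single_apply]
  split_ifs with h <;> simp [h]

/-- Operators `T` with `T ρ(x) = ρ'(x) T` for some operators `ρ'(x)` are zero or injective. -/
lemma injective_of_intertwines [CharZero K] [Finite X] (hψ : ψ ≠ 1)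
    (T : (S.L' → K) →ₗ[K] (S.L' → K)) (R : X → (S.L' → K) →ₗ[K] (S.L' → K))
    (hT : ∀ x, T ∘ₗ S.schrodinger ψ x = R x ∘ₗ T) (h0 : T ≠ 0) : Function.Injective T := by
  classical
  have : Fintype X := Fintype.ofFinite X
  have hT' : ∀ x f, T (S.schrodinger ψ x f) = R x (T f) := fun x f => LinearMap.congr_fun (hT x) f
  rw [injective_iff_map_eq_zero]
  intro f hf
  by_contra hne
  apply h0
  obtain ⟨v, hv⟩ := Function.ne_iff.1 hne
  have h1 : T (Pi.single v 1) = 0 := by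
    have := congrArg T (S.sum_schrodinger ψ hψ f v)
    simp only [map_sum, map_smul, hT', hf, map_zero, smul_zero, Finset.sum_const_zero] at this
    have hc : (Fintype.card S.L : K) * f v ≠ 0 :=
      mul_ne_zero (Nat.cast_ne_zero.2 Fintype.card_ne_zero) hv
    exact (smul_eq_zero.1 this.symm).resolve_left hc
  have h2 : ∀ w : S.L', T (Pi.single w 1) = 0 := by
    intro w
    have : S.schrodinger ψ ((w - v : S.L') : X) (Pi.single v (1 : K)) = Pi.single w 1 := by
      ext u
      simp only [schrodinger_L', Pi.single_apply]
      congr 1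
      rw [eq_iff_iff]
      constructor
      · intro h; rw [sub_eq_iff_eq_add] at h; simpa using h
      · rintro rfl; simp
    rw [← this, hT', h1, map_zero]
  refine LinearMap.pi_ext' fun w => ?_
  ext1
  simpa using h2 w

/-- Schur's lemma for the Schrödinger representation. -/
lemma schur [CharZero K] [Finite X] (hψ : ψ ≠ 1) (C : (S.L' → K) →ₗ[K] (S.L' → K))
    (hC : ∀ x, C ∘ₗ S.schrodinger ψ x = S.schrodinger ψ x ∘ₗ C) :
    ∃ c : K, C = c • LinearMap.id := by
  classical
  have : Fintype X := Fintype.ofFinite X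
  have hC' : ∀ x f, C (S.schrodinger ψ x f) = S.schrodinger ψ x (C f) :=
    fun x f => LinearMap.congr_fun (hC x) f
  refine ⟨C (Pi.single 0 1) 0, LinearMap.pi_ext' fun w => ?_⟩
  have h0 : C (Pi.single 0 1) = C (Pi.single 0 1) 0 • Pi.single 0 1 := by
    have h1 := congrArg C (S.sum_schrodinger ψ hψ (Pi.single 0 1) 0)
    have h2 := S.sum_schrodinger ψ hψ (C (Pi.single 0 1)) 0
    simp only [map_sum, map_smul, hC'] at h1
    rw [h1, mul_smul, mul_smul] at h2
    have hc : (Fintype.card S.L : K) ≠ 0 := Nat.cast_ne_zero.2 Fintype.card_ne_zero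
    simpa using smul_right_injective _ hc h2
  ext1
  simp only [LinearMap.comp_apply, LinearMap.single_apply, LinearMap.smul_apply, LinearMap.id_apply]
  rw [← S.schrodinger_single ψ w, hC']
  conv_lhs => rw [h0]
  simp

lemma trace_schrodinger [Fintype S.L'] [DecidableEq S.L'] (hψ : ψ ≠ 1)
    {x : X} (hx : x ≠ 0) : ∑ v : S.L', S.schrodinger ψ x (Pi.single v 1) v = 0 := by
  by_cases hb : S.snd x = 0
  · have ha : S.fst x ≠ 0 := by
      intro ha
      apply hx
      rw [← S.fst_add_snd x, ha, hb]
      simp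
    simp [schrodinger_apply, hb, S.sum_L' ψ hψ _ ha]
  · apply Finset.sum_eq_zero
    intro v _
    simp [schrodinger_apply, hb]

/-- For each symplectic `g` there is a nonzero `T` with `T ρ(x) = ρ(g x) T`. -/
lemma exists_intertwiner [CharZero K] [Finite X] (h2 : (2 : F) ≠ 0) (hψ : ψ ≠ 1) (g : S.Sp) :
    ∃ T : (S.L' → K) →ₗ[K] (S.L' → K), T ≠ 0 ∧
      ∀ x, T ∘ₗ S.schrodinger ψ x = S.schrodinger ψ (g.1 x) ∘ₗ T := by
  classical
  have : Fintype X := Fintype.ofFinite X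
  let A : S.L' → (S.L' → K) →ₗ[K] (S.L' → K) := fun u =>
    (LinearMap.proj (0 : S.L')).smulRight (Pi.single u (1 : K))
  let T : S.L' → (S.L' → K) →ₗ[K] (S.L' → K) := fun u =>
    ∑ x : X, S.schrodinger ψ (g.1 x) ∘ₗ A u ∘ₗ S.schrodinger ψ (-x)
  have hT : ∀ u x, T u ∘ₗ S.schrodinger ψ x = S.schrodinger ψ (g.1 x) ∘ₗ T u := by
    intro u y
    simp only [T]
    rw [← Module.End.mul_eq_comp, ← Module.End.mul_eq_comp, Finset.sum_mul, Finset.mul_sum]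
    simp only [Module.End.mul_eq_comp]
    conv_lhs => rw [← Equiv.sum_comp (Equiv.addLeft y)]
    refine Finset.sum_congr rfl fun x _ => ?_
    have e1 : (S.schrodinger ψ (g.1 (Equiv.addLeft y x)) ∘ₗ A u ∘ₗ
        S.schrodinger ψ (-(Equiv.addLeft y x))) ∘ₗ S.schrodinger ψ y =
        S.schrodinger ψ (g.1 (Equiv.addLeft y x)) ∘ₗ A u ∘ₗ
        (S.schrodinger ψ (-(Equiv.addLeft y x)) ∘ₗ S.schrodinger ψ y) := rfl
    have e2 : S.schrodinger ψ (g.1 y) ∘ₗ S.schrodinger ψ (g.1 x) ∘ₗ A u ∘ₗ S.schrodinger ψ (-x) =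
        (S.schrodinger ψ (g.1 y) ∘ₗ S.schrodinger ψ (g.1 x)) ∘ₗ A u ∘ₗ S.schrodinger ψ (-x) := rfl
    rw [e1, e2, S.schrodinger_mul ψ h2, S.schrodinger_mul ψ h2, g.2 y x]
    simp only [Equiv.coe_addLeft, LinearMap.comp_smul, LinearMap.smul_comp, map_add]
    have e3 : S.form (-(y + x)) y = S.form y x := by
      simp [S.isAlt.self_eq_zero y, S.form_swap x y]
    rw [e3]
    congr 4
    abel
  by_contra! hcon
  have hz : ∀ u, T u = 0 := fun u => by
    by_contra h
    obtain ⟨x, hx⟩ := hcon (T u) h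
    exact hx (hT u x)
  have h1 : ∑ u : S.L', T u (fun _ => 1) u = 0 := by simp [hz]
  simp only [T, A, LinearMap.sum_apply, LinearMap.comp_apply, LinearMap.smulRight_apply,
    LinearMap.proj_apply, map_smul, Finset.sum_apply, Pi.smul_apply, smul_eq_mul] at h1
  rw [Finset.sum_comm] at h1
  simp only [← Finset.mul_sum] at h1
  rw [Finset.sum_eq_single 0] at h1
  · simp [schrodinger_zero] at h1
  · intro x _ hx
    rw [S.trace_schrodinger ψ hψ, mul_zero]
    simpa using hx
  · simp

/-- The operator `f ↦ (v ↦ f (-v))`. -/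
def parity : (S.L' → K) →ₗ[K] (S.L' → K) := LinearMap.funLeft K K (fun v => -v)

lemma sum_all_schrodinger [Finite X] [Fintype X] [Fintype S.L] (h2 : (2 : F) ≠ 0) (hψ : ψ ≠ 1) :
    ∑ x : X, S.schrodinger ψ x = (Fintype.card S.L : K) • S.parity (K := K) := by
  classical
  have : Fintype S.L' := Fintype.ofFinite _
  rw [← Equiv.sum_comp (Submodule.prodEquivOfIsCompl S.L S.L' S.isCompl).toEquiv,
    Fintype.sum_prod_type_right]
  refine LinearMap.ext fun f => funext fun v => ?_
  have key : ∀ (b : S.L') (a : S.L), S.schrodinger ψ ((a : X) + b) f v =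
      ψ (S.form a ((v - (2⁻¹ : F) • b : S.L') : X)) * f (v - b) := by
    intro b a
    simp [schrodinger_apply]
  simp only [LinearMap.sum_apply, Finset.sum_apply, LinearEquiv.coe_toEquiv,
    Submodule.coe_prodEquivOfIsCompl', key, ← Finset.sum_mul, S.sum_L ψ hψ]
  rw [Finset.sum_eq_single ((2 : F) • v)]
  · have hz : v - (2⁻¹ : F) • (2 : F) • v = 0 := by
      rw [smul_smul, inv_mul_cancel₀ h2, one_smul, sub_self]
    have hz' : v - (2 : F) • v = -v := by rw [two_smul]; simp
    rw [if_pos hz, hz']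
    rfl
  · intro b _ hb
    rw [if_neg, zero_mul]
    intro h
    apply hb
    rw [sub_eq_zero] at h
    rw [h, smul_smul, mul_inv_cancel₀ h2, one_smul]
  · simp

lemma parity_comm [CharZero K] [Finite X] (h2 : (2 : F) ≠ 0) (hψ : ψ ≠ 1)
    (T : (S.L' → K) →ₗ[K] (S.L' → K)) (g : X ≃ₗ[F] X)
    (hT : ∀ x, T ∘ₗ S.schrodinger ψ x = S.schrodinger ψ (g x) ∘ₗ T) :
    T ∘ₗ S.parity = S.parity ∘ₗ T := by
  classical
  have : Fintype X := Fintype.ofFinite X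
  have h1 : T * ∑ x : X, S.schrodinger ψ x = (∑ x : X, S.schrodinger ψ x) * T := by
    rw [Finset.mul_sum, Finset.sum_mul, ← Equiv.sum_comp g.toEquiv (fun x => S.schrodinger ψ x * T)]
    exact Finset.sum_congr rfl fun x _ => hT x
  rw [S.sum_all_schrodinger ψ h2 hψ, mul_smul_comm, smul_mul_assoc] at h1
  have hc : (Fintype.card S.L : K) ≠ 0 := Nat.cast_ne_zero.2 Fintype.card_ne_zero
  exact smul_right_injective _ hc h1

/-- The even functions. -/
def evenPart (K : Type*) [Field K] : Submodule K (S.L' → K) :=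
  LinearMap.ker (S.parity - LinearMap.id)

lemma parity_parity : S.parity (K := K) ∘ₗ S.parity = LinearMap.id := by
  refine LinearMap.ext fun f => ?_
  ext v
  simp [parity, LinearMap.funLeft_apply]

/-- The projection onto the even functions. -/
def evenProj (K : Type*) [Field K] : (S.L' → K) →ₗ[K] (S.L' → K) :=
  (2⁻¹ : K) • (LinearMap.id + S.parity)

lemma isProj_evenProj [CharZero K] : LinearMap.IsProj (S.evenPart K) (S.evenProj K) where
  map_mem f := by
    have := LinearMap.congr_fun (S.parity_parity (K := K)) f
    simp only [LinearMap.comp_apply, LinearMap.id_apply] at this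
    simp only [evenPart, evenProj, LinearMap.mem_ker, LinearMap.sub_apply, LinearMap.smul_apply,
      LinearMap.add_apply, LinearMap.id_apply, map_smul, map_add, this]
    rw [add_comm, sub_add_sub_cancel, sub_self, smul_zero]
  map_id f hf := by
    have : S.parity f = f := by simpa [evenPart, sub_eq_zero] using hf
    simp only [evenProj, LinearMap.smul_apply, LinearMap.add_apply, LinearMap.id_apply, this]
    rw [← two_smul K f, smul_smul, inv_mul_cancel₀ two_ne_zero, one_smul]

lemma finrank_evenPart [CharZero K] [Finite X] (h2 : (2 : F) ≠ 0) :
    2 * Module.finrank K (S.evenPart K) = Module.finrank K (S.L' → K) + 1 := by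
  classical
  have : Fintype S.L' := Fintype.ofFinite _
  have h := (S.isProj_evenProj (K := K)).trace
  have hp : LinearMap.trace K _ (S.parity (K := K)) = 1 := by
    rw [LinearMap.trace_eq_matrix_trace K (Pi.basisFun K S.L'), Matrix.trace,
      Finset.sum_eq_single 0]
    · simp [parity, LinearMap.funLeft_apply]
    · intro v _ hv
      have : -v ≠ v := by
        intro h
        apply hv
        have h3 : (2 : F) • v = 0 := by
          rw [two_smul]; nth_rewrite 1 [← h]; simp
        exact (smul_eq_zero.1 h3).resolve_left h2
      simp [parity, LinearMap.funLeft_apply, this]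
    · simp
  rw [evenProj, map_smul, map_add, LinearMap.trace_id, hp, smul_eq_mul,
    inv_mul_eq_iff_eq_mul₀ two_ne_zero] at h
  exact_mod_cast h.symm

/-- The determinant of the even block of an operator. -/
def evenDet [CharZero K] (T : (S.L' → K) →ₗ[K] (S.L' → K)) : K :=
  LinearMap.det ((S.isProj_evenProj (K := K)).codRestrict ∘ₗ T ∘ₗ (S.evenPart K).subtype)

lemma evenDet_smul [CharZero K] (c : K) (T : (S.L' → K) →ₗ[K] (S.L' → K)) :
    S.evenDet (c • T) = c ^ Module.finrank K (S.evenPart K) * S.evenDet T := by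
  rw [evenDet, LinearMap.smul_comp, LinearMap.comp_smul, LinearMap.det_smul, evenDet]

lemma evenDet_comp [CharZero K] (T T' : (S.L' → K) →ₗ[K] (S.L' → K))
    (h' : T' ∘ₗ S.parity = S.parity ∘ₗ T') :
    S.evenDet (T ∘ₗ T') = S.evenDet T * S.evenDet T' := by
  rw [evenDet, evenDet, evenDet, ← LinearMap.det_comp]
  congr 1
  refine LinearMap.ext fun f => ?_
  apply Subtype.ext
  have hf : S.evenProj K (f : S.L' → K) = f := S.isProj_evenProj.map_id _ f.2
  have hc : S.evenProj K (T' f) = T' f := by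
    conv_rhs => rw [← hf]
    have := LinearMap.congr_fun h' f
    simp only [LinearMap.comp_apply] at this
    simp [evenProj, this]
  simp only [LinearMap.comp_apply, Submodule.subtype_apply,
    LinearMap.IsProj.codRestrict_apply, hc]

/-- A scalar-valued function that is homogeneous of degree `-1` and multiplicative. -/
def normalizer [CharZero K] (T : (S.L' → K) →ₗ[K] (S.L' → K)) : K :=
  LinearMap.det T / S.evenDet T ^ 2

lemma normalizer_smul [CharZero K] [Finite X] (h2 : (2 : F) ≠ 0) (c : K) (hc : c ≠ 0)
    (T : (S.L' → K) →ₗ[K] (S.L' → K)) :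
    S.normalizer (c • T) • (c • T) = S.normalizer T • T := by
  rw [smul_smul]
  congr 1
  rw [normalizer, normalizer, evenDet_smul, LinearMap.det_smul, mul_pow, ← pow_mul,
    mul_comm _ 2, S.finrank_evenPart h2, pow_succ]
  field_simp

lemma normalizer_id [CharZero K] : S.normalizer (LinearMap.id (M := S.L' → K)) = 1 := by
  have : (S.isProj_evenProj (K := K)).codRestrict ∘ₗ LinearMap.id ∘ₗ (S.evenPart K).subtype =
      LinearMap.id := by
    refine LinearMap.ext fun f => ?_
    simp
  rw [normalizer, evenDet, this]
  simp

/-- Existence of the Weil representation. -/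
theorem exists_isWeil [CharZero K] [Finite X] (h2 : (2 : F) ≠ 0) (hψ : ψ ≠ 1) :
    ∃ ω : Representation K S.Sp (S.L' → K), S.IsWeil ψ ω := by
  choose T hT0 hT using S.exists_intertwiner ψ h2 hψ
  have hinj : ∀ g, Function.Injective (T g) := fun g =>
    S.injective_of_intertwines ψ hψ (T g) (fun x => S.schrodinger ψ (g.1 x)) (hT g) (hT0 g)
  have hpar : ∀ g, T g ∘ₗ S.parity = S.parity ∘ₗ T g := fun g =>
    S.parity_comm ψ h2 hψ (T g) g.1 (hT g)
  -- two nonzero intertwiners for `g` are proportional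
  have huniq : ∀ (g : S.Sp) (A : (S.L' → K) →ₗ[K] (S.L' → K)), A ≠ 0 →
      (∀ x, A ∘ₗ S.schrodinger ψ x = S.schrodinger ψ (g.1 x) ∘ₗ A) →
      ∃ c : K, c ≠ 0 ∧ A = c • T g := by
    intro g A hA0 hA
    let e := LinearEquiv.ofInjectiveEndo (T g) (hinj g)
    have he : ∀ f, e f = T g f := fun f => rfl
    obtain ⟨c, hc⟩ := S.schur ψ hψ (e.symm.toLinearMap ∘ₗ A) (by
      intro x
      refine LinearMap.ext fun f => ?_
      apply e.injective
      have h1 := LinearMap.congr_fun (hA x) f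
      have h3 := LinearMap.congr_fun (hT g x) (e.symm (A f))
      simp only [LinearMap.comp_apply] at h1 h3
      simp only [LinearMap.comp_apply, LinearEquiv.coe_coe, LinearEquiv.apply_symm_apply]
      rw [he (S.schrodinger ψ x _), h1, h3, ← he, LinearEquiv.apply_symm_apply])
    have hA' : A = c • T g := by
      refine LinearMap.ext fun f => ?_
      have := congrArg e (LinearMap.congr_fun hc f)
      rw [LinearMap.comp_apply, LinearEquiv.coe_coe, LinearEquiv.apply_symm_apply] at this
      simpa [he] using this
    refine ⟨c, ?_, hA'⟩
    rintro rfl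
    exact hA0 (by simpa using hA')
  have hone : ∃ c : K, c ≠ 0 ∧ LinearMap.id = c • T 1 := by
    refine huniq 1 LinearMap.id ?_ fun x => rfl
    intro h
    have := congrFun (LinearMap.congr_fun h (fun _ => 1)) 0
    simp at this
  have hmul : ∀ g h, ∃ c : K, c ≠ 0 ∧ T g ∘ₗ T h = c • T (g * h) := by
    intro g h
    refine huniq (g * h) _ ?_ fun x => ?_
    · intro h0
      apply hT0 h
      refine LinearMap.ext fun f => ?_
      apply hinj g
      simpa using LinearMap.congr_fun h0 f
    · rw [LinearMap.comp_assoc, hT h, ← LinearMap.comp_assoc, hT g, LinearMap.comp_assoc]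
      rfl
  refine ⟨⟨⟨fun g => S.normalizer (T g) • T g, ?_⟩, ?_⟩, ?_⟩
  · obtain ⟨c, hc, h⟩ := hone
    rw [← S.normalizer_smul h2 c hc, ← h, normalizer_id, one_smul]
    rfl
  · intro g h
    obtain ⟨c, hc, e⟩ := hmul g h
    change S.normalizer (T (g * h)) • T (g * h) =
      (S.normalizer (T g) • T g) ∘ₗ (S.normalizer (T h) • T h)
    rw [← S.normalizer_smul h2 c hc, ← e, LinearMap.smul_comp, LinearMap.comp_smul, smul_smul,
      normalizer, normalizer, normalizer, S.evenDet_comp _ _ (hpar h), LinearMap.det_comp]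
    congr 1
    ring
  · intro g x
    change (S.normalizer (T g) • T g) ∘ₗ _ = _ ∘ₗ (S.normalizer (T g) • T g)
    rw [LinearMap.smul_comp, LinearMap.comp_smul, hT]

/-- The Weil representation attached to `ψ` (unique, except for two-dimensional spaces over `𝔽₃`:
two representations `ω` as in `IsWeil` differ by a character of the symplectic group). -/
def weilRep [CharZero K] [Finite X] (h2 : (2 : F) ≠ 0) (hψ : ψ ≠ 1) :
    Representation K S.Sp (S.L' → K) :=
  (S.exists_isWeil ψ h2 hψ).choose

lemma isWeil_weilRep [CharZero K] [Finite X] (h2 : (2 : F) ≠ 0) (hψ : ψ ≠ 1) :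
    S.IsWeil ψ (S.weilRep ψ h2 hψ) :=
  (S.exists_isWeil ψ h2 hψ).choose_spec

end Weil
end PolarizedSymplecticSpace

section NormForm

variable (F E : Type*) [Field F] [Fintype F] [Field E] [Algebra F E] [FiniteDimensional F E]

/-- The conjugation `x ↦ x ^ q`, where `q` is the order of `F`. -/
abbrev conjugation : E ≃ₗ[F] E :=
  (FiniteField.frobeniusAlgEquivOfAlgebraic F E).toLinearEquiv

/-- The symmetric bilinear form `⟨x, y⟩ = (x y ^ q + x ^ q y) / 2` attached to the norm of the
quadratic extension `E / F`, written as `Tr (x y ^ q) / 2`. -/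
def normForm : LinearMap.BilinForm F E :=
  (2⁻¹ : F) • (Algebra.traceForm F E).compRight (conjugation F E).toLinearMap

/-- The orthogonal group of `E` with its norm form. -/
abbrev OE : Subgroup (E ≃ₗ[F] E) := isometryGroup (normForm F E)

variable {F E}

/-- The sign character of `O(E)`: `1` on `SO(E)` and `-1` elsewhere. -/
def signOE (t : OE F E) : ℤ :=
  open Classical in if LinearMap.det t.1.toLinearMap = 1 then 1 else -1

lemma normForm_apply (x y : E) :
    normForm F E x y = 2⁻¹ * Algebra.trace F E (x * y ^ Fintype.card F) := rfl

lemma pow_card_pow_card (hE : Module.finrank F E = 2) (x : E) :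
    (x ^ Fintype.card F) ^ Fintype.card F = x := by
  have : Finite E := Module.finite_of_finite F
  have : Fintype E := Fintype.ofFinite E
  rw [← pow_mul, ← pow_two, ← hE, ← Module.card_eq_pow_finrank, FiniteField.pow_card]

lemma algebraMap_normForm (hE : Module.finrank F E = 2) (x y : E) :
    algebraMap F E (normForm F E x y) =
      2⁻¹ * (x * y ^ Fintype.card F + x ^ Fintype.card F * y) := by
  have : Finite E := Module.finite_of_finite F
  rw [normForm_apply, map_mul, FiniteField.algebraMap_trace_eq_sum_pow, hE]
  simp only [Finset.sum_range_succ, Finset.sum_range_zero, zero_add, pow_zero, pow_one, mul_pow,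
    pow_card_pow_card hE, Nat.card_eq_fintype_card, map_inv₀, map_ofNat]

lemma normForm_comm (hE : Module.finrank F E = 2) (x y : E) :
    normForm F E x y = normForm F E y x := by
  apply (algebraMap F E).injective
  rw [algebraMap_normForm hE, algebraMap_normForm hE]
  ring

lemma normForm_nondegenerate (h2 : (2 : F) ≠ 0) (hE : Module.finrank F E = 2) :
    (normForm F E).Nondegenerate := by
  have hs : (normForm F E).SeparatingLeft := by
    intro x hx
    apply (traceForm_nondegenerate F E).1 x
    intro y
    have := hx ((conjugation F E).symm y)
    have h3 : normForm F E x ((conjugation F E).symm y) = 2⁻¹ * Algebra.traceForm F E x y := by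
      change 2⁻¹ * Algebra.traceForm F E x (conjugation F E ((conjugation F E).symm y)) = _
      rw [LinearEquiv.apply_symm_apply]
    rw [h3] at this
    exact (mul_eq_zero.1 this).resolve_left (inv_ne_zero h2)
  refine ⟨hs, fun y hy => hs y fun x => ?_⟩
  rw [normForm_comm hE]
  exact hy x

lemma conjugation_mem (hE : Module.finrank F E = 2) :
    conjugation F E ∈ isometryGroup (normForm F E) := by
  intro x y
  apply (algebraMap F E).injective
  rw [algebraMap_normForm hE, algebraMap_normForm hE]
  simp only [conjugation, AlgEquiv.toLinearEquiv_apply, FiniteField.coe_frobeniusAlgEquivOfAlgebraic,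
    pow_card_pow_card hE]
  ring

end NormForm

namespace PolarizedSymplecticSpace

section Tensor

variable {F E V K : Type*} [Field F] [Fintype F] [Field E] [Algebra F E] [FiniteDimensional F E]
  [AddCommGroup V] [Module F V] [FiniteDimensional F V] [Field K] [CharZero K]
  (S : PolarizedSymplecticSpace F V)

/-- The subspace `N ⊗ E` of `V ⊗ E`. -/
def tensorSubspace (E : Type*) [Field E] [Algebra F E] (N : Submodule F V) :
    Submodule F (V ⊗[F] E) :=
  LinearMap.range (N.subtype.rTensor E)

lemma tensor_nondegenerate {W : Type*} [AddCommGroup W] [Module F W] [FiniteDimensional F W]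
    {B : LinearMap.BilinForm F V} {C : LinearMap.BilinForm F W}
    (hB : B.Nondegenerate) (hC : C.Nondegenerate) (hr : (B.tmul C).IsRefl) :
    (B.tmul C).Nondegenerate := by
  have h : B.tmul C = ((TensorProduct.congr (B.toDual hB) (C.toDual hC)).trans
      (TensorProduct.dualDistribEquiv F V W)).toLinearMap := by
    ext v w v' w'
    simp [TensorProduct.dualDistribEquiv, TensorProduct.dualDistribEquivOfBasis,
      LinearMap.BilinForm.toDual_def, mul_comm]
  rw [hr.nondegenerate_iff_separatingLeft, LinearMap.separatingLeft_iff_ker_eq_bot, h]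
  exact LinearEquiv.ker _

lemma tensor_isotropic {W : Type*} [AddCommGroup W] [Module F W]
    (B : LinearMap.BilinForm F V) (C : LinearMap.BilinForm F W) (N : Submodule F V)
    (hN : ∀ x ∈ N, ∀ y ∈ N, B x y = 0) (x y : N ⊗[F] W) :
    B.tmul C (N.subtype.rTensor W x) (N.subtype.rTensor W y) = 0 := by
  have : (B.tmul C).compl₁₂ (N.subtype.rTensor W) (N.subtype.rTensor W) = 0 := by
    ext a e b f
    simp [hN a a.2 b b.2]
  exact LinearMap.congr_fun₂ this x y

lemma tensor_isCompl {M N : Submodule F V} (h : IsCompl M N) :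
    IsCompl (tensorSubspace E M) (tensorSubspace E N) := by
  have h1 : ∀ x : M ⊗[F] E,
      (N.projectionOnto M h.symm).rTensor E (M.subtype.rTensor E x) = 0 := by
    intro x
    rw [← LinearMap.comp_apply, ← LinearMap.rTensor_comp]
    have : N.projectionOnto M h.symm ∘ₗ M.subtype = 0 := by ext x; simp
    simp [this]
  have h2 : ∀ x : N ⊗[F] E,
      (N.projectionOnto M h.symm).rTensor E (N.subtype.rTensor E x) = x := by
    intro x
    rw [← LinearMap.comp_apply, ← LinearMap.rTensor_comp]
    have : N.projectionOnto M h.symm ∘ₗ N.subtype = LinearMap.id := by ext x; simp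
    simp [this]
  constructor
  · rw [Submodule.disjoint_def]
    rintro _ ⟨x, rfl⟩ ⟨y, hy⟩
    have := h1 x
    rw [← hy, h2] at this
    rw [← hy, this, map_zero]
  · rw [codisjoint_iff, eq_top_iff]
    rintro x -
    induction x with
    | zero => exact zero_mem _
    | add x y hx hy => exact add_mem hx hy
    | tmul v e =>
      obtain ⟨a, ha, b, hb, rfl⟩ := Submodule.mem_sup.1 (h.sup_eq_top ▸ Submodule.mem_top (x := v))
      rw [TensorProduct.add_tmul]
      exact Submodule.add_mem_sup ⟨⟨a, ha⟩ ⊗ₜ e, by simp⟩ ⟨⟨b, hb⟩ ⊗ₜ e, by simp⟩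

lemma lagrangian_of_isotropic {X : Type*} [AddCommGroup X] [Module F X]
    {B : LinearMap.BilinForm F X} (hB : B.Nondegenerate) {M N : Submodule F X}
    (h : IsCompl M N) (hM : ∀ x ∈ M, ∀ y ∈ M, B x y = 0) (hN : ∀ x ∈ N, ∀ y ∈ N, B x y = 0) :
    B.orthogonal M = M := by
  apply le_antisymm
  · intro x hx
    obtain ⟨a, ha, b, hb, rfl⟩ := Submodule.mem_sup.1 (h.sup_eq_top ▸ Submodule.mem_top (x := x))
    have : b = 0 := by
      apply hB.2
      intro y
      obtain ⟨c, hc, d, hd, rfl⟩ :=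
        Submodule.mem_sup.1 (h.sup_eq_top ▸ Submodule.mem_top (x := y))
      have h1 := hx c hc
      have h1 : B c (a + b) = 0 := h1
      rw [map_add, hM c hc a ha, zero_add] at h1
      rw [map_add, LinearMap.add_apply, h1, hN d hd b hb, zero_add]
    simpa [this] using ha
  · intro y hy x hx
    exact hM x hx y hy

lemma tensor_isAlt (h2 : (2 : F) ≠ 0) (hE : Module.finrank F E = 2) :
    (S.form.tmul (normForm F E)).IsAlt := by
  have h : S.form.tmul (normForm F E) = -(S.form.tmul (normForm F E)).flip := by
    ext v e w f
    simp [normForm_comm hE e f, S.form_swap v w]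
  intro x
  have := LinearMap.congr_fun₂ h x x
  simp only [LinearMap.neg_apply, LinearMap.flip_apply] at this
  have h3 : (2 : F) * S.form.tmul (normForm F E) x x = 0 := by
    rw [two_mul]
    nth_rewrite 1 [this]
    simp
  exact (mul_eq_zero.1 h3).resolve_left h2

lemma tensor_nondegenerate' (h2 : (2 : F) ≠ 0) (hE : Module.finrank F E = 2) :
    (S.form.tmul (normForm F E)).Nondegenerate :=
  tensor_nondegenerate S.nondegenerate (normForm_nondegenerate h2 hE) (S.tensor_isAlt h2 hE).isRefl

/-- The symplectic space `V ⊗ E`, with the tensor product of the symplectic form of `V` and the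
norm form of `E`, and with the Lagrangian subspaces `L ⊗ E` and `L' ⊗ E`. -/
def tensor (h2 : (2 : F) ≠ 0) (hE : Module.finrank F E = 2) :
    PolarizedSymplecticSpace F (V ⊗[F] E) where
  form := S.form.tmul (normForm F E)
  isAlt := S.tensor_isAlt h2 hE
  nondegenerate := S.tensor_nondegenerate' h2 hE
  L := tensorSubspace E S.L
  L' := tensorSubspace E S.L'
  lagrangian := by
    refine lagrangian_of_isotropic (S.tensor_nondegenerate' h2 hE)
      (tensor_isCompl S.isCompl) ?_ ?_
    · rintro _ ⟨x, rfl⟩ _ ⟨y, rfl⟩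
      exact tensor_isotropic _ _ _ (fun a ha b hb => S.form_LL ⟨a, ha⟩ ⟨b, hb⟩) _ _
    · rintro _ ⟨x, rfl⟩ _ ⟨y, rfl⟩
      exact tensor_isotropic _ _ _ (fun a ha b hb => S.form_LL' ⟨a, ha⟩ ⟨b, hb⟩) _ _
  lagrangian' := by
    refine lagrangian_of_isotropic (S.tensor_nondegenerate' h2 hE)
      (tensor_isCompl S.isCompl).symm ?_ ?_
    · rintro _ ⟨x, rfl⟩ _ ⟨y, rfl⟩
      exact tensor_isotropic _ _ _ (fun a ha b hb => S.form_LL' ⟨a, ha⟩ ⟨b, hb⟩) _ _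
    · rintro _ ⟨x, rfl⟩ _ ⟨y, rfl⟩
      exact tensor_isotropic _ _ _ (fun a ha b hb => S.form_LL ⟨a, ha⟩ ⟨b, hb⟩) _ _
  isCompl := tensor_isCompl S.isCompl

/-- The natural map `Sp(V) × O(E) → Sp(V ⊗ E)`, `(g, t) ↦ g ⊗ t`. -/
def dualPair (h2 : (2 : F) ≠ 0) (hE : Module.finrank F E = 2) :
    S.Sp × OE F E →* (S.tensor h2 hE).Sp where
  toFun p := ⟨TensorProduct.congr p.1.1 p.2.1, by
    have : (S.form.tmul (normForm F E)).compl₁₂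
        (TensorProduct.congr p.1.1 p.2.1).toLinearMap
        (TensorProduct.congr p.1.1 p.2.1).toLinearMap = S.form.tmul (normForm F E) := by
      ext v e w f
      simp [p.1.2 v w, p.2.2 e f]
    exact fun x y => LinearMap.congr_fun₂ this x y⟩
  map_one' := by
    apply Subtype.ext
    exact TensorProduct.congr_refl_refl
  map_mul' p p' := by
    apply Subtype.ext
    exact TensorProduct.congr_mul _ _ _ _

variable (ψ : AddChar F K) (h2 : (2 : F) ≠ 0) (hE : Module.finrank F E = 2) (hψ : ψ ≠ 1)

/-- The Weil representation `W` of `Sp(V ⊗ E)`, restricted to `Sp(V) × O(E)`. -/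
def weilPair : Representation K (S.Sp × OE F E) ((S.tensor (E := E) h2 hE).L' → K) :=
  have : Finite (V ⊗[F] E) := Module.finite_of_finite F
  ((S.tensor h2 hE).weilRep ψ h2 hψ).comp (S.dualPair h2 hE)

/-- The representation `W₁⁻` of `Sp(V)`: the vectors of `W` fixed by `SO(E)` on which the
conjugation of `E` acts by `-1`. -/
def W1minus : Subrepresentation
    ((S.weilPair ψ h2 hE hψ).comp (MonoidHom.inl S.Sp (OE F E))) where
  toSubmodule :=
    (⨅ t : OE F E, ⨅ _ : LinearMap.det t.1.toLinearMap = 1,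
      LinearMap.ker (S.weilPair ψ h2 hE hψ (1, t) - LinearMap.id)) ⊓
    LinearMap.ker (S.weilPair ψ h2 hE hψ (1, ⟨conjugation F E, conjugation_mem hE⟩) +
      LinearMap.id)
  apply_mem_toSubmodule g f hf := by
    have hc : ∀ (t : OE F E) (f), S.weilPair ψ h2 hE hψ (1, t)
        (S.weilPair ψ h2 hE hψ (g, 1) f) =
        S.weilPair ψ h2 hE hψ (g, 1) (S.weilPair ψ h2 hE hψ (1, t) f) := by
      intro t f
      rw [← Module.End.mul_apply, ← Module.End.mul_apply, ← map_mul, ← map_mul]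
      simp
    simp only [Submodule.mem_inf, Submodule.mem_iInf, LinearMap.mem_ker, LinearMap.sub_apply,
      LinearMap.add_apply, LinearMap.id_apply, MonoidHom.comp_apply, MonoidHom.inl_apply,
      hc] at hf ⊢
    refine ⟨fun t ht => ?_, ?_⟩
    · rw [← map_sub, hf.1 t ht, map_zero]
    · rw [← map_add, hf.2, map_zero]

lemma mem_W1minus (f : (S.tensor (E := E) h2 hE).L' → K) :
    f ∈ (S.W1minus ψ h2 hE hψ).toSubmodule ↔
      (∀ t : OE F E, LinearMap.det t.1.toLinearMap = 1 → S.weilPair ψ h2 hE hψ (1, t) f = f) ∧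
      S.weilPair ψ h2 hE hψ (1, ⟨conjugation F E, conjugation_mem hE⟩) f = -f := by
  simp [W1minus, sub_eq_zero, add_eq_zero_iff_eq_neg]

end Tensor

section Parabolic

variable {F E V K : Type*} [Field F] [Fintype F] [Field E] [Algebra F E] [FiniteDimensional F E]
  [AddCommGroup V] [Module F V] [FiniteDimensional F V] [Field K]
  (S : PolarizedSymplecticSpace F V)

/-- The Siegel parabolic subgroup `P₁`: the stabilizer of `L`. -/
def siegelParabolic : Subgroup S.Sp where
  carrier := {g | S.L.map g.1.toLinearMap = S.L}
  mul_mem' := by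
    intro a b ha hb
    have : (a * b).1.toLinearMap = a.1.toLinearMap ∘ₗ b.1.toLinearMap := rfl
    simp only [Set.mem_ofPred_eq] at ha hb ⊢
    rw [this, Submodule.map_comp, hb, ha]
  one_mem' := Submodule.map_id _
  inv_mem' := by
    intro a ha
    simp only [Set.mem_ofPred_eq] at ha ⊢
    conv_lhs => rw [← ha]
    rw [← Submodule.map_comp]
    have : (a⁻¹).1.toLinearMap ∘ₗ a.1.toLinearMap = LinearMap.id := by
      ext x; exact a.1.symm_apply_apply x
    rw [this, Submodule.map_id]

/-- The Levi subgroup `M₁`: the stabilizer of the pair `(L, L')`. -/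
def levi : Subgroup S.Sp where
  carrier := {g | S.L.map g.1.toLinearMap = S.L ∧ S.L'.map g.1.toLinearMap = S.L'}
  mul_mem' := by
    intro a b ha hb
    have : (a * b).1.toLinearMap = a.1.toLinearMap ∘ₗ b.1.toLinearMap := rfl
    simp only [Set.mem_ofPred_eq] at ha hb ⊢
    rw [this, Submodule.map_comp, hb.1, ha.1, Submodule.map_comp, hb.2, ha.2]
    exact ⟨rfl, rfl⟩
  one_mem' := ⟨Submodule.map_id _, Submodule.map_id _⟩
  inv_mem' := by
    intro a ha
    simp only [Set.mem_ofPred_eq] at ha ⊢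
    have : (a⁻¹).1.toLinearMap ∘ₗ a.1.toLinearMap = LinearMap.id := by
      ext x; exact a.1.symm_apply_apply x
    constructor
    · conv_lhs => rw [← ha.1]
      rw [← Submodule.map_comp, this, Submodule.map_id]
    · conv_lhs => rw [← ha.2]
      rw [← Submodule.map_comp, this, Submodule.map_id]

/-- The unipotent radical `U₁` of `P₁`: the symplectic maps that are the identity on `L`. -/
def unipotentRadical : Subgroup S.Sp where
  carrier := {g | ∀ x ∈ S.L, g.1 x = x}
  mul_mem' := by
    intro a b ha hb x hx
    change a.1 (b.1 x) = x
    rw [hb x hx, ha x hx]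
  one_mem' := fun _ _ => rfl
  inv_mem' := by
    intro a ha x hx
    conv_lhs => rw [← ha x hx]
    exact a.1.symm_apply_apply x

/-- The indecomposable vectors of `L' ⊗ E`. -/
def indecomposable (E : Type*) [Field E] [Algebra F E] : Set (V ⊗[F] E) :=
  {v | v ∈ tensorSubspace E S.L' ∧ ∀ x ∈ S.L', ∀ e : E, v ≠ x ⊗ₜ e}

/-- The `O(E)`-orbit of a vector of `V ⊗ E`. -/
def orbitOE (v : V ⊗[F] E) : Set (V ⊗[F] E) :=
  {w | ∃ t : OE F E, w = TensorProduct.congr (LinearEquiv.refl F V) t.1 v}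

/-- The function `φ(g) = ψ (⟨v, v⟩_g / 2)` on `U₁`, where `⟨v, w⟩_g = ⟨(g ⊗ 1 - 1) v, w⟩` is the
symmetric bilinear form on `L' ⊗ E` attached to `g`. -/
def phi (ψ : AddChar F K) (v : V ⊗[F] E) (g : S.Sp) : K :=
  ψ (2⁻¹ * S.form.tmul (normForm F E)
    (TensorProduct.congr g.1 (LinearEquiv.refl F E) v - v) v)

/-- The subgroup `O` of `M₁`: the stabilizer of the `O(E)`-orbit of `v`. -/
def orbitStabilizer (v : V ⊗[F] E) : Subgroup S.Sp where
  carrier := {g | g ∈ S.levi ∧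
    TensorProduct.congr g.1 (LinearEquiv.refl F E) '' orbitOE v = orbitOE v}
  mul_mem' := by
    rintro a b ⟨ha, ha'⟩ ⟨hb, hb'⟩
    refine ⟨mul_mem ha hb, ?_⟩
    have : ⇑(TensorProduct.congr (a * b).1 (LinearEquiv.refl F E)) =
        TensorProduct.congr a.1 (LinearEquiv.refl F E) ∘
        TensorProduct.congr b.1 (LinearEquiv.refl F E) := by
      ext x
      exact LinearMap.congr_fun (LinearMap.rTensor_comp E a.1.toLinearMap b.1.toLinearMap) x
    rw [this, Set.image_comp, hb', ha']
  one_mem' := by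
    refine ⟨one_mem _, ?_⟩
    have : ⇑(TensorProduct.congr (1 : S.Sp).1 (LinearEquiv.refl F E)) = id := by
      ext x
      exact LinearMap.congr_fun (LinearMap.rTensor_id (R := F) E V) x
    rw [this, Set.image_id]
  inv_mem' := by
    rintro a ⟨ha, ha'⟩
    refine ⟨inv_mem ha, ?_⟩
    conv_lhs => rw [← ha']
    rw [← Set.image_comp]
    have : ⇑(TensorProduct.congr (a⁻¹).1 (LinearEquiv.refl F E)) ∘
        TensorProduct.congr a.1 (LinearEquiv.refl F E) = id := by
      ext x
      exact (TensorProduct.congr a.1 (LinearEquiv.refl F E)).symm_apply_apply x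
    rw [this, Set.image_id]

/-- The subgroup `O U₁` of `P₁`; here `O` normalizes `U₁`. -/
abbrev inducingSubgroup (v : V ⊗[F] E) : Subgroup S.siegelParabolic :=
  (S.orbitStabilizer v ⊔ S.unipotentRadical).subgroupOf S.siegelParabolic

/-- The restriction of `W₁⁻` to `P₁`. -/
def W1minusRes [CharZero K] (ψ : AddChar F K) (h2 : (2 : F) ≠ 0)
    (hE : Module.finrank F E = 2) (hψ : ψ ≠ 1) :
    Representation K S.siegelParabolic (S.W1minus ψ h2 hE hψ).toSubmodule :=
  (S.W1minus ψ h2 hE hψ).toRepresentation.comp S.siegelParabolic.subtype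

end Parabolic

end PolarizedSymplecticSpace

/-- The one-dimensional representation given by a character. -/
def charRep {G K : Type*} [Group G] [Field K] (χ : G →* Kˣ) : Representation K G K where
  toFun g := (χ g : K) • LinearMap.id
  map_one' := by simp [Module.End.one_eq_id]
  map_mul' g h := by ext; simp [mul_comm]

end

/-!
In the Schrödinger model the Siegel parabolic subgroup of `Sp(V ⊗ E)` permutes the functions
supported at one point of `L' ⊗ E` up to scalars (`weil_apply`): the Levi subgroup acts
geometrically, and the unipotent radical acts diagonally through `ψ`, both up to a character
`weilScalar` of the parabolic subgroup. On the part of `Sp(V) × O(E)` that matters this character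
is trivial:

* on an involution `m ⊗ 1` or `1 ⊗ t` of `L ⊗ E`, since a second tensor factor of dimension two
  allows one to write it as the product of two conjugate involutions
  (`map_involution_eq_one_of_swap`), and `O(E)` is generated by involutions (`map_OE_eq_one`);
* on `U₁`, since every `u ⊗ 1` is conjugate to its inverse and has odd order
  (`weilScalar_unipotentRadical`).

Hence `W₁⁻` consists of the functions `f` on `L' ⊗ E` with `f (t w) = ε(t) f w` for `t ∈ O(E)`
(`mem_W1minus_iff_forall`), and these vanish on decomposable vectors, which are fixed by a
reflection. A vector `v` of `L' ⊗ E` is the same as a linear map `hat v : L → E`, and it is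
indecomposable exactly when this map is an isomorphism. Therefore `O(E)` acts freely and `M₁`
transitively on the indecomposable vectors, the stabilizer in `M₁` of the orbit of `v` is a copy of
`O(E)`, and the character `phi` of `U₁` attached to `v`, which knows the pullback to `L` of the norm
form of `E`, determines the `O(E)`-orbit of `v` (`exists_congr_eq_of_phi_eq`).

So `W₁⁻` has a basis of functions `orbitFun v`, one for each orbit, on which `U₁` acts by distinct
characters and which `M₁` permutes transitively up to scalars. Projecting a nonzero vector to an
eigenspace of `U₁` shows that it generates `W₁⁻` under `P₁` (`W1minus_le_of_ne_zero`), and the line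
of `orbitFun v`, stable under `O U₁`, induces `W₁⁻` (`Representation.nonempty_equiv_ind`).
-/

noncomputable section

set_option linter.unusedSectionVars false

/-! ### Induced representations and characters of linear groups -/

/-- Recognition of a representation induced from a character: an irreducible representation
containing an eigenvector `f` of `H` for the character `χ`, and a linear form that separates `f`
from its translates by elements outside `H`. -/
theorem Representation.nonempty_equiv_ind {G K W : Type*} [Group G] [Finite G] [Field K]
    [CharZero K] [AddCommGroup W] [Module K W] (ρ : Representation K G W)
    (hρ : ρ.IsIrreducible) (H : Subgroup G) (χ : H →* Kˣ) (f : W) (l : W →ₗ[K] K)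
    (hl : l f = 1) (hf : ∀ h : H, ρ h f = (χ h : K) • f) (h0 : ∀ g ∉ H, l (ρ g f) = 0) :
    Nonempty (ρ.Equiv (Representation.ind H.subtype (charRep χ))) := by
  classical
  have : Fintype G := Fintype.ofFinite G
  let Φ : Representation.IndV H.subtype (charRep χ) →ₗ[K] W :=
    Representation.Coinvariants.lift _
      (TensorProduct.lift <| (Finsupp.lift _ _ _ fun h => ρ h⁻¹ ∘ₗ LinearMap.toSpanSingleton K W f)
        ∘ₗ (MonoidAlgebra.coeffLinearEquiv K).toLinearMap) (by
      intro h
      ext g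
      have : ρ (h : G)⁻¹ f = ((χ h : K)⁻¹) • f := by
        have := hf h⁻¹
        simpa using this
      simp [charRep, this, smul_smul])
  have hΦ : ∀ (g : G) (a : K),
      Φ (Representation.IndV.mk H.subtype (charRep χ) g a) = a • ρ g⁻¹ f := by
    intro g a
    simp [Φ]
  have hmk : ∀ (h : H) (g : G), (χ h : K) •
      Representation.IndV.mk H.subtype (charRep χ) (h * g) 1 =
      Representation.IndV.mk H.subtype (charRep χ) g 1 := by
    intro h g
    rw [← map_smul]
    have := Representation.Coinvariants.mk_self_apply
      (Representation.tprod ((Representation.leftRegular K G).comp H.subtype) (charRep χ)) h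
      ((MonoidAlgebra.single g 1) ⊗ₜ 1)
    simp only [charRep, Representation.tprod_apply, MonoidHom.comp_apply, MonoidHom.coe_mk,
      OneHom.coe_mk, TensorProduct.map_tmul, Representation.leftRegular, H.coe_subtype,
      Representation.ofMulAction_single, smul_eq_mul, LinearMap.smul_apply,
      LinearMap.id_apply] at this
    exact this
  -- averaging over `G` gives a left inverse of `Φ`: only the `g ∈ H g'` contribute at `ρ g'⁻¹ f`
  let Ψ : W →ₗ[K] Representation.IndV H.subtype (charRep χ) :=
    (Nat.card H : K)⁻¹ • ∑ g : G, (l ∘ₗ ρ g).smulRight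
      (Representation.IndV.mk H.subtype (charRep χ) g 1)
  have hΨ : ∀ w, Ψ w = (Nat.card H : K)⁻¹ • ∑ g : G, l (ρ g w) •
      Representation.IndV.mk H.subtype (charRep χ) g 1 := by
    intro w
    simp only [Ψ, LinearMap.smul_apply, LinearMap.sum_apply, LinearMap.smulRight_apply]
    rfl
  have hΨΦ : Ψ ∘ₗ Φ = LinearMap.id := by
    refine Representation.IndV.hom_ext _ _ fun g => LinearMap.ext_ring ?_
    rw [LinearMap.comp_apply, LinearMap.comp_apply, hΦ, one_smul, hΨ,
      ← Equiv.sum_comp (Equiv.mulRight g)]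
    have h1 : ∀ x : G, l (ρ (Equiv.mulRight g x) (ρ g⁻¹ f)) = l (ρ x f) := by
      intro x
      rw [← Module.End.mul_apply, ← map_mul]
      simp
    have h2 : ∀ x : G, l (ρ (Equiv.mulRight g x) (ρ g⁻¹ f)) •
        Representation.IndV.mk H.subtype (charRep χ) (Equiv.mulRight g x) 1 =
        if x ∈ H then Representation.IndV.mk H.subtype (charRep χ) g 1 else 0 := by
      intro x
      rw [h1]
      split_ifs with hx
      · rw [hf ⟨x, hx⟩, map_smul, hl, smul_eq_mul, mul_one]
        exact hmk ⟨x, hx⟩ g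
      · rw [h0 x hx, zero_smul]
    simp only [h2]
    rw [Finset.sum_ite, Finset.sum_const_zero, add_zero, Finset.sum_const,
      ← Nat.cast_smul_eq_nsmul K, smul_smul, ← Fintype.card_subtype, Nat.card_eq_fintype_card]
    have : ((Fintype.card {x // x ∈ H} : ℕ) : K) ≠ 0 := Nat.cast_ne_zero.2 Fintype.card_ne_zero
    rw [inv_mul_cancel₀ this, one_smul]
    rfl
  have hinter : ∀ g, Φ ∘ₗ Representation.ind H.subtype (charRep χ) g = ρ g ∘ₗ Φ := by
    intro g
    refine Representation.IndV.hom_ext _ _ fun g' => LinearMap.ext_ring ?_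
    change Φ (Representation.ind H.subtype (charRep χ) g
      (Representation.IndV.mk H.subtype (charRep χ) g' 1)) =
      ρ g (Φ (Representation.IndV.mk H.subtype (charRep χ) g' 1))
    rw [Representation.ind_mk, hΦ, hΦ, mul_inv_rev, inv_inv, map_mul]
    simp
  have hinj : Function.Injective Φ :=
    Function.LeftInverse.injective (g := Ψ) fun x => LinearMap.congr_fun hΨΦ x
  have hsurj : Function.Surjective Φ := by
    let R : Subrepresentation ρ := ⟨LinearMap.range Φ, by
      rintro g _ ⟨x, rfl⟩
      exact ⟨_, LinearMap.congr_fun (hinter g) x⟩⟩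
    have hR : R ≠ ⊥ := by
      intro h
      have h1 : f ∈ R.toSubmodule := ⟨Representation.IndV.mk H.subtype (charRep χ) 1 1, by
        rw [hΦ]; simp⟩
      rw [h] at h1
      have h1 : f = 0 := h1
      rw [h1, map_zero] at hl
      exact zero_ne_one hl
    have hT : R = ⊤ := (hρ.eq_bot_or_eq_top R).resolve_left hR
    have : R.toSubmodule = ⊤ := by rw [hT]; rfl
    exact LinearMap.range_eq_top.1 this
  exact ⟨(Representation.Equiv.mk (LinearEquiv.ofBijective Φ ⟨hinj, hsurj⟩) hinter).symm⟩

/-- An involution `g` commuting with an idempotent `P` and with an element `s` conjugating `P` to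
`1 - P` is killed by every homomorphism to a commutative monoid: `g` is the product of the
involution `g P + (1 - P)` and of a conjugate of it. -/
lemma map_involution_eq_one_of_swap {R A : Type*} [Ring R] [CommMonoid A] (χ : Rˣ →* A)
    (g s : Rˣ) (P : R) (hg : g * g = 1) (hP : P * P = P) (hgP : P * g = g * P)
    (hs : s * g = g * s) (hsP : s * P = (1 - P) * s) : χ g = 1 := by
  have hg' : (g : R) * g = 1 := congrArg Units.val hg
  have hs' : (s : R) * g = g * s := congrArg Units.val hs
  have hA : ((g : R) * P + (1 - P)) * (g * P + (1 - P)) = 1 := by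
    have e1 : (g : R) * P * (g * P) = P := by
      rw [mul_assoc, ← mul_assoc P, hgP, mul_assoc, hP, ← mul_assoc, hg', one_mul]
    have e2 : P * ((g : R) * P) = g * P := by rw [← mul_assoc, hgP, mul_assoc, hP]
    simp only [mul_add, add_mul, mul_sub, sub_mul, mul_one, one_mul, e1, e2, mul_assoc, hP]
    abel
  let a : Rˣ := ⟨g * P + (1 - P), g * P + (1 - P), hA, hA⟩
  have haa : a * a = 1 := Units.ext hA
  have hgs : g * s = a * (s * a) := by
    apply Units.ext
    change (g : R) * s = (g * P + (1 - P)) * (s * (g * P + (1 - P)))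
    have e1 : (s : R) * (g * P + (1 - P)) = (g * (1 - P) + P) * s := by
      rw [mul_add, ← mul_assoc, hs', mul_assoc, hsP, mul_sub, hsP, sub_mul, mul_one]
      noncomm_ring
    have e2 : P * ((g : R) * P) = g * P := by rw [← mul_assoc, hgP, mul_assoc, hP]
    rw [e1, ← mul_assoc]
    congr 1
    simp only [mul_add, add_mul, mul_sub, sub_mul, mul_one, one_mul, e2, mul_assoc, hP, hgP]
    abel
  have h1 : χ g * χ s = χ s := by
    rw [← map_mul, hgs, map_mul, map_mul, mul_left_comm, ← map_mul χ a, haa, map_one, mul_one]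
  calc χ g = χ g * χ (s * s⁻¹) := by simp
    _ = 1 := by rw [map_mul, ← mul_assoc, h1, ← map_mul, mul_inv_cancel, map_one]

/-- A plane has an idempotent endomorphism conjugate to its complement. -/
lemma exists_isIdempotentElem_swap {F N : Type*} [Field F] [AddCommGroup N] [Module F N]
    (hN : Module.finrank F N = 2) :
    ∃ (P : Module.End F N) (s : N ≃ₗ[F] N), P * P = P ∧
      s.toLinearMap ∘ₗ P = (1 - P) ∘ₗ s.toLinearMap := by
  have : FiniteDimensional F N := Module.finite_of_finrank_eq_succ hN
  let b := Module.finBasisOfFinrankEq F N hN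
  refine ⟨b.constr F ![b 0, 0], b.equiv b (Equiv.swap 0 1), ?_, ?_⟩
  · refine b.ext fun i => ?_
    fin_cases i <;> simp
  · refine b.ext fun i => ?_
    fin_cases i <;> simp

/-- A homomorphism on `GL(M ⊗ N)` kills `m ⊗ 1` for an involution `m`, if `N` is a plane: a
decomposition of `N` into two lines splits `m ⊗ 1` into two conjugate involutions. -/
lemma map_congr_refl_eq_one {F M N A : Type*} [Field F] [AddCommGroup M] [Module F M]
    [AddCommGroup N] [Module F N] (hN : Module.finrank F N = 2) [CommMonoid A]
    (χ : ((M ⊗[F] N) ≃ₗ[F] (M ⊗[F] N)) →* A) (m : M ≃ₗ[F] M) (hm : m * m = 1) :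
    χ (TensorProduct.congr m (LinearEquiv.refl F N)) = 1 := by
  obtain ⟨P, s, hP, hs⟩ := exists_isIdempotentElem_swap hN
  let γ := LinearMap.GeneralLinearGroup.generalLinearEquiv F (M ⊗[F] N)
  have hm' : ∀ x, m (m x) = x := fun x => LinearEquiv.congr_fun hm x
  have key := map_involution_eq_one_of_swap (χ.comp γ.toMonoidHom)
    (γ.symm (TensorProduct.congr m (LinearEquiv.refl F N)))
    (γ.symm (TensorProduct.congr (LinearEquiv.refl F M) s)) (P.lTensor M)
    (by
      rw [← map_mul, ← map_one γ.symm]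
      congr 1
      apply LinearEquiv.toLinearMap_injective
      ext x y
      simp [hm'])
    (by rw [← LinearMap.lTensor_mul, hP])
    (by
      ext x y
      rfl)
    (by
      rw [← map_mul, ← map_mul]
      congr 1
      apply LinearEquiv.toLinearMap_injective
      ext x y
      simp)
    (by
      ext x y
      have := LinearMap.congr_fun hs y
      simp only [LinearMap.comp_apply] at this
      change x ⊗ₜ[F] s (P y) = x ⊗ₜ[F] s y - x ⊗ₜ[F] (P (s y))
      rw [← TensorProduct.tmul_sub]
      congr 1)
  simpa using key

/-- Transport of automorphisms along a linear equivalence. -/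
def LinearEquiv.autConj {F M N : Type*} [Field F] [AddCommGroup M] [Module F M]
    [AddCommGroup N] [Module F N] (e : M ≃ₗ[F] N) : (M ≃ₗ[F] M) →* (N ≃ₗ[F] N) where
  toFun f := e.symm.trans (f.trans e)
  map_one' := by ext; simp
  map_mul' f g := by ext; simp

lemma map_refl_congr_eq_one {F M N A : Type*} [Field F] [AddCommGroup M] [Module F M]
    [AddCommGroup N] [Module F N] (hM : Module.finrank F M = 2) [CommMonoid A]
    (χ : ((M ⊗[F] N) ≃ₗ[F] (M ⊗[F] N)) →* A) (n : N ≃ₗ[F] N) (hn : n * n = 1) :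
    χ (TensorProduct.congr (LinearEquiv.refl F M) n) = 1 := by
  rw [← map_congr_refl_eq_one hM
    (χ.comp (LinearEquiv.autConj (TensorProduct.comm F N M))) n hn]
  simp only [MonoidHom.comp_apply]
  congr 1
  apply LinearEquiv.toLinearMap_injective
  ext x y
  rfl

namespace PolarizedSymplecticSpace

section Siegel

variable {F X K : Type*} [Field F] [Fintype F] [AddCommGroup X] [Module F X]
  [FiniteDimensional F X] [Field K] (S : PolarizedSymplecticSpace F X) (ψ : AddChar F K)

/-! ### The Siegel parabolic subgroup and its Levi subgroup -/

lemma mem_siegelParabolic_of_forall {g : S.Sp} (h : ∀ a ∈ S.L, g.1 a ∈ S.L) :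
    g ∈ S.siegelParabolic := by
  refine Submodule.eq_of_le_of_finrank_eq ?_ (LinearEquiv.finrank_map_eq g.1 S.L)
  rintro _ ⟨a, ha, rfl⟩
  exact h a ha

lemma mem_levi_of_forall {g : S.Sp} (h : ∀ a ∈ S.L, g.1 a ∈ S.L)
    (h' : ∀ a ∈ S.L', g.1 a ∈ S.L') : g ∈ S.levi := by
  refine ⟨S.mem_siegelParabolic_of_forall h,
    Submodule.eq_of_le_of_finrank_eq ?_ (LinearEquiv.finrank_map_eq g.1 S.L')⟩
  rintro _ ⟨a, ha, rfl⟩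
  exact h' a ha

lemma apply_mem_L {g : S.Sp} (hg : g ∈ S.siegelParabolic) {a : X} (ha : a ∈ S.L) :
    g.1 a ∈ S.L := by
  have : S.L.map g.1.toLinearMap = S.L := hg
  rw [← this]
  exact ⟨a, ha, rfl⟩

lemma levi_le : S.levi ≤ S.siegelParabolic := fun _ hg => hg.1

lemma unipotentRadical_le : S.unipotentRadical ≤ S.siegelParabolic := fun g hg =>
  S.mem_siegelParabolic_of_forall fun a ha => by rwa [hg a ha]

lemma apply_mem_L' {g : S.Sp} (hg : g ∈ S.levi) {a : X} (ha : a ∈ S.L') :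
    g.1 a ∈ S.L' := by
  rw [← hg.2]
  exact ⟨a, ha, rfl⟩

lemma snd_eq_zero_iff (x : X) : S.snd x = 0 ↔ x ∈ S.L := by
  simp [snd]

lemma fst_of_mem {x : X} (hx : x ∈ S.L) : S.fst x = ⟨x, hx⟩ := S.fst_L ⟨x, hx⟩

lemma snd_apply_snd {g : S.Sp} (hg : g ∈ S.siegelParabolic) (x : X) :
    S.snd (g.1 (S.snd x)) = S.snd (g.1 x) := by
  conv_rhs => rw [← S.fst_add_snd x, map_add, map_add]
  rw [(S.snd_eq_zero_iff _).2 (S.apply_mem_L hg (S.fst x).2), zero_add]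

lemma eq_of_form_L_eq {w w' : X} (hw : w ∈ S.L') (hw' : w' ∈ S.L')
    (h : ∀ a ∈ S.L, S.form a w = S.form a w') : w = w' := by
  by_contra hne
  obtain ⟨a, ha⟩ := S.exists_form_ne (w := ⟨w, hw⟩ - ⟨w', hw'⟩) (by
    rw [sub_ne_zero]
    exact fun h => hne (congrArg Subtype.val h))
  apply ha
  rw [Submodule.coe_sub, map_sub, sub_eq_zero]
  exact h a a.2

lemma exists_apply_eq_of_mem_L {g : S.Sp} (hg : g ∈ S.siegelParabolic) {a : X} (ha : a ∈ S.L) :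
    ∃ b ∈ S.L, g.1 b = a := by
  have : S.L.map g.1.toLinearMap = S.L := hg
  rw [← this] at ha
  exact ha

/-- An element of the Levi subgroup is determined by its restriction to `L`. -/
lemma levi_ext {g g' : S.Sp} (hg : g ∈ S.levi) (hg' : g' ∈ S.levi)
    (h : ∀ a ∈ S.L, g.1 a = g'.1 a) : g = g' := by
  have h' : ∀ w ∈ S.L', g.1 w = g'.1 w := by
    intro w hw
    refine S.eq_of_form_L_eq (S.apply_mem_L' hg hw) (S.apply_mem_L' hg' hw) fun a ha => ?_
    obtain ⟨b, hb, rfl⟩ := S.exists_apply_eq_of_mem_L hg.1 ha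
    rw [g.2 b w, h b hb, g'.2 b w]
  apply Subtype.ext
  ext x
  rw [← S.fst_add_snd x, map_add, map_add, h _ (S.fst x).2, h' _ (S.snd x).2]

/-- The pairing of `L` and `L'`, as an injection `L' → L^*`. -/
def pairing : S.L' →ₗ[F] Module.Dual F S.L :=
  (S.form.flip.compl₁₂ S.L'.subtype S.L.subtype)

lemma pairing_injective : Function.Injective S.pairing := by
  intro w w' h
  apply Subtype.ext
  refine S.eq_of_form_L_eq w.2 w'.2 fun a ha => ?_
  exact LinearMap.congr_fun h ⟨a, ha⟩

lemma finrank_L_eq : Module.finrank F S.L = Module.finrank F S.L' := by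
  apply le_antisymm
  · let f : S.L →ₗ[F] Module.Dual F S.L' := S.form.compl₁₂ S.L.subtype S.L'.subtype
    have hf : Function.Injective f := by
      rw [injective_iff_map_eq_zero]
      intro a ha
      by_contra hne
      obtain ⟨w, hw⟩ := S.exists_form_ne' hne
      exact hw (LinearMap.congr_fun ha w)
    have := LinearMap.finrank_le_finrank_of_injective hf
    rwa [Subspace.dual_finrank_eq] at this
  · have := LinearMap.finrank_le_finrank_of_injective S.pairing_injective
    rwa [Subspace.dual_finrank_eq] at this

lemma finrank_add_finrank : Module.finrank F S.L + Module.finrank F S.L' = Module.finrank F X := by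
  exact Submodule.finrank_add_eq_of_isCompl S.isCompl

/-- The perfect pairing of `L` and `L'`. -/
def pairingEquiv : S.L' ≃ₗ[F] Module.Dual F S.L :=
  LinearEquiv.ofInjectiveOfFinrankEq S.pairing S.pairing_injective
    (by rw [Subspace.dual_finrank_eq, S.finrank_L_eq])

lemma pairingEquiv_apply (w : S.L') (a : S.L) : S.pairingEquiv w a = S.form a w := rfl

/-- The contragredient of an automorphism of `L`, acting on `L'`. -/
def contragredient (h : S.L ≃ₗ[F] S.L) : S.L' ≃ₗ[F] S.L' :=
  S.pairingEquiv.trans (h.symm.dualMap.trans S.pairingEquiv.symm)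

lemma form_contragredient (h : S.L ≃ₗ[F] S.L) (a : S.L) (w : S.L') :
    S.form (h a) (S.contragredient h w) = S.form a w := by
  rw [← pairingEquiv_apply, contragredient]
  simp [pairingEquiv_apply]

/-- The element of the Levi subgroup that restricts to a given automorphism of `L`. -/
def leviOf (h : S.L ≃ₗ[F] S.L) : S.Sp :=
  ⟨(Submodule.prodEquivOfIsCompl S.L S.L' S.isCompl).symm.trans
    ((h.prodCongr (S.contragredient h)).trans (Submodule.prodEquivOfIsCompl S.L S.L' S.isCompl)), by
    have key : ∀ p : S.L × S.L', ((Submodule.prodEquivOfIsCompl S.L S.L' S.isCompl).symm.trans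
        ((h.prodCongr (S.contragredient h)).trans
        (Submodule.prodEquivOfIsCompl S.L S.L' S.isCompl))) ((p.1 : X) + p.2) =
        (h p.1 : X) + S.contragredient h p.2 := by
      intro p
      rw [← Submodule.coe_prodEquivOfIsCompl' S.L S.L' S.isCompl p]
      simp
    intro x y
    rw [← S.fst_add_snd x, ← S.fst_add_snd y, key (S.fst x, S.snd x), key (S.fst y, S.snd y)]
    simp only [map_add, LinearMap.add_apply, form_LL, form_LL', form_contragredient]
    rw [S.form_swap (S.contragredient h _), S.form_swap (S.snd x), form_contragredient]⟩

lemma leviOf_apply_L (h : S.L ≃ₗ[F] S.L) (a : S.L) : (S.leviOf h).1 a = h a := by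
  have := Submodule.coe_prodEquivOfIsCompl' S.L S.L' S.isCompl (a, 0)
  simp only [Submodule.coe_zero, add_zero] at this
  simp only [leviOf]
  rw [← this]
  simp

lemma leviOf_apply_L' (h : S.L ≃ₗ[F] S.L) (w : S.L') :
    (S.leviOf h).1 w = S.contragredient h w := by
  have := Submodule.coe_prodEquivOfIsCompl' S.L S.L' S.isCompl (0, w)
  simp only [Submodule.coe_zero, zero_add] at this
  simp only [leviOf]
  rw [← this]
  simp

lemma leviOf_mem (h : S.L ≃ₗ[F] S.L) : S.leviOf h ∈ S.levi := by
  refine S.mem_levi_of_forall (fun a ha => ?_) fun w hw => ?_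
  · rw [S.leviOf_apply_L h ⟨a, ha⟩]
    exact Subtype.mem _
  · rw [S.leviOf_apply_L' h ⟨w, hw⟩]
    exact Subtype.mem _

lemma leviOf_mul (h k : S.L ≃ₗ[F] S.L) : S.leviOf (h * k) = S.leviOf h * S.leviOf k := by
  refine S.levi_ext (S.leviOf_mem _) (mul_mem (S.leviOf_mem _) (S.leviOf_mem _)) fun a ha => ?_
  change _ = (S.leviOf h).1 ((S.leviOf k).1 a)
  rw [S.leviOf_apply_L k ⟨a, ha⟩, S.leviOf_apply_L, S.leviOf_apply_L (h * k) ⟨a, ha⟩]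
  rfl

/-- The restriction of an element of the Siegel parabolic subgroup to `L`. -/
def restrictL (g : S.Sp) (hg : g ∈ S.siegelParabolic) : S.L ≃ₗ[F] S.L :=
  g.1.ofSubmodules S.L S.L hg

lemma coe_restrictL (g : S.Sp) (hg : g ∈ S.siegelParabolic) (a : S.L) :
    (S.restrictL g hg a : X) = g.1 a := rfl

/-- The Levi decomposition `P₁ = M₁ U₁`. -/
lemma exists_levi_mul_unipotent {g : S.Sp} (hg : g ∈ S.siegelParabolic) :
    ∃ m ∈ S.levi, ∃ u ∈ S.unipotentRadical, g = m * u := by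
  refine ⟨S.leviOf (S.restrictL g hg), S.leviOf_mem _, (S.leviOf (S.restrictL g hg))⁻¹ * g, ?_,
    by simp⟩
  intro a ha
  change (S.leviOf (S.restrictL g hg)).1.symm (g.1 a) = a
  rw [LinearEquiv.symm_apply_eq, S.leviOf_apply_L _ ⟨a, ha⟩]
  rfl

/-! ### The Weil representation on the Siegel parabolic subgroup -/

variable {ψ} {ω : Representation K S.Sp (S.L' → K)}

/-- A vector of the Schrödinger representation that is fixed by `L` is supported at `0`. -/
lemma eq_zero_of_schrodinger_L_fixed (hψ : ψ ≠ 1) {f : S.L' → K}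
    (hf : ∀ a : S.L, S.schrodinger ψ a f = f) {w : S.L'} (hw : w ≠ 0) : f w = 0 := by
  obtain ⟨a, ha⟩ := S.exists_form_ne hw
  obtain ⟨t, ht⟩ := (AddChar.ne_one_iff).1 hψ
  have h := congrFun (hf ((t / S.form a w) • a)) w
  rw [schrodinger_L] at h
  have e : S.form ((t / S.form a w) • a : S.L) w = t := by
    rw [Submodule.coe_smul, map_smul, LinearMap.smul_apply, smul_eq_mul, div_mul_cancel₀ _ ha]
  rw [e, ← sub_eq_zero, ← sub_one_mul] at h
  exact (mul_eq_zero.1 h).resolve_left (sub_ne_zero.2 ht)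

open Classical in
/-- The scalar by which an element of the Siegel parabolic subgroup acts on the function
supported at `0`. -/
def weilScalar (ω : Representation K S.Sp (S.L' → K)) (g : S.Sp) : K := ω g (Pi.single 0 1) 0

open Classical in
/-- The function supported at `0` spans the vectors fixed by `L`, so the Siegel parabolic subgroup
acts on it by scalars. -/
lemma weil_single_zero (hψ : ψ ≠ 1) (hω : S.IsWeil ψ ω) {g : S.Sp} (hg : g ∈ S.siegelParabolic) :
    ω g (Pi.single 0 1) = S.weilScalar ω g • Pi.single 0 1 := by
  have hfix : ∀ a : S.L, S.schrodinger ψ a (ω g (Pi.single 0 1)) = ω g (Pi.single 0 1) := by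
    intro a
    obtain ⟨b, hb, hba⟩ := S.exists_apply_eq_of_mem_L hg a.2
    have h := LinearMap.congr_fun (hω g b) (Pi.single 0 1)
    simp only [LinearMap.comp_apply, hba] at h
    rw [← h]
    congr 1
    ext v
    have := S.schrodinger_L ψ ⟨b, hb⟩ (Pi.single 0 1) v
    rw [this, Pi.single_apply]
    split_ifs with hv <;> simp [hv]
  ext v
  by_cases hv : v = 0
  · subst hv
    simp [weilScalar]
  · rw [S.eq_zero_of_schrodinger_L_fixed hψ hfix hv]
    simp [hv]

open Classical in
lemma weil_single (hψ : ψ ≠ 1) (hω : S.IsWeil ψ ω) {g : S.Sp} (hg : g ∈ S.siegelParabolic)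
    (h2 : (2 : F) ≠ 0) (w : S.L') :
    ω g (Pi.single w 1) = (S.weilScalar ω g *
      ψ (2⁻¹ * S.form (S.fst (g.1 w)) (S.snd (g.1 w)))) • Pi.single (S.snd (g.1 w)) 1 := by
  have h := LinearMap.congr_fun (hω g w) (Pi.single 0 1)
  simp only [LinearMap.comp_apply] at h
  rw [schrodinger_single, S.weil_single_zero hψ hω hg, map_smul] at h
  rw [h, mul_smul]
  congr 1
  ext v
  rw [schrodinger_apply, Pi.smul_apply, Pi.single_apply, Pi.single_apply]
  by_cases hv : v = S.snd (g.1 w)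
  · subst hv
    simp only [sub_self, if_true, mul_one, smul_eq_mul]
    congr 1
    field_simp
    ring
  · rw [if_neg (by rwa [sub_eq_zero]), if_neg hv, mul_zero, smul_zero]

/-- The action of the Siegel parabolic subgroup in the Schrödinger model, up to the scalar
`weilScalar`. -/
lemma weil_apply (hψ : ψ ≠ 1) (hω : S.IsWeil ψ ω) {g : S.Sp} (hg : g ∈ S.siegelParabolic)
    (h2 : (2 : F) ≠ 0) (f : S.L' → K) (w : S.L') :
    ω g f (S.snd (g.1 w)) = S.weilScalar ω g *
      ψ (2⁻¹ * S.form (S.fst (g.1 w)) (S.snd (g.1 w))) * f w := by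
  classical
  have : Finite X := Module.finite_of_finite F
  have : Fintype S.L' := Fintype.ofFinite _
  conv_lhs => rw [pi_eq_sum_univ' f]
  have hinj : ∀ v : S.L', S.snd (g.1 w) = S.snd (g.1 v) → w = v := by
    intro v hv
    have h1 := S.snd_apply_snd (inv_mem hg) (g.1 w)
    have h3 := S.snd_apply_snd (inv_mem hg) (g.1 v)
    rw [hv, h3] at h1
    have hcan : ∀ x : X, (g⁻¹).1 (g.1 x) = x := g.1.symm_apply_apply
    simpa [hcan] using h1.symm
  simp only [map_sum, map_smul, Finset.sum_apply, Pi.smul_apply, smul_eq_mul,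
    S.weil_single hψ hω hg h2]
  rw [Finset.sum_eq_single w]
  · simp
    ring
  · intro v _ hv
    rw [Pi.single_eq_of_ne, mul_zero, mul_zero]
    exact fun h => hv (hinj v h).symm
  · simp

lemma weilScalar_one : S.weilScalar ω 1 = 1 := by
  simp [weilScalar]

lemma weilScalar_mul (hψ : ψ ≠ 1) (hω : S.IsWeil ψ ω) {g h : S.Sp} (hg : g ∈ S.siegelParabolic)
    (hh : h ∈ S.siegelParabolic) :
    S.weilScalar ω (g * h) = S.weilScalar ω g * S.weilScalar ω h := by
  classical
  have : ω (g * h) (Pi.single 0 1) = (S.weilScalar ω h * S.weilScalar ω g) • Pi.single 0 1 := by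
    rw [map_mul, Module.End.mul_apply, S.weil_single_zero hψ hω hh, map_smul,
      S.weil_single_zero hψ hω hg, mul_smul]
  rw [weilScalar, this]
  simp [mul_comm]

/-- The scalars `weilScalar` form a character of the Siegel parabolic subgroup. -/
def weilScalarHom (hψ : ψ ≠ 1) (hω : S.IsWeil ψ ω) : S.siegelParabolic →* K where
  toFun g := S.weilScalar ω g
  map_one' := S.weilScalar_one
  map_mul' g h := S.weilScalar_mul hψ hω g.2 h.2

end Siegel

end PolarizedSymplecticSpace

/-! ### The orthogonal group of the norm form -/

section NormForm

variable {F E : Type*} [Field F] [Fintype F] [Field E] [Algebra F E] [FiniteDimensional F E]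

lemma conjugation_conjugation (hE : Module.finrank F E = 2) (x : E) :
    conjugation F E (conjugation F E x) = x := pow_card_pow_card hE x

lemma conjugation_mul (x y : E) :
    conjugation F E (x * y) = conjugation F E x * conjugation F E y := mul_pow x y _

lemma conjugation_inv (x : E) : conjugation F E x⁻¹ = (conjugation F E x)⁻¹ := inv_pow x _

lemma conjugation_one : conjugation F E 1 = 1 := one_pow _

lemma algebraMap_normForm' (hE : Module.finrank F E = 2) (x y : E) :
    algebraMap F E (normForm F E x y) =
      2⁻¹ * (x * conjugation F E y + conjugation F E x * y) := algebraMap_normForm hE x y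

lemma two_ne_zero_ext (h2 : (2 : F) ≠ 0) : (2 : E) ≠ 0 := by
  rw [← map_ofNat (algebraMap F E) 2]
  exact (map_ne_zero _).2 h2

lemma algebraMap_normForm_self (h2 : (2 : F) ≠ 0) (hE : Module.finrank F E = 2) (x : E) :
    algebraMap F E (normForm F E x x) = x * conjugation F E x := by
  have := two_ne_zero_ext (E := E) h2
  rw [algebraMap_normForm' hE]
  field_simp
  ring

lemma exists_conjugation_ne (hE : Module.finrank F E = 2) : ∃ x : E, conjugation F E x ≠ x := by
  by_contra! h
  have : Finite E := Module.finite_of_finite F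
  have h1 := FiniteField.orderOf_frobeniusAlgEquivOfAlgebraic F E
  have h3 : FiniteField.frobeniusAlgEquivOfAlgebraic F E = 1 := AlgEquiv.ext h
  rw [h3, orderOf_one, hE] at h1
  exact absurd h1 (by norm_num)

/-- There is a basis `1, δ` of `E` with `δ` of trace zero. -/
lemma exists_basis_one_trace_zero (h2 : (2 : F) ≠ 0) (hE : Module.finrank F E = 2) :
    ∃ b : Module.Basis (Fin 2) F E, b 0 = 1 ∧ conjugation F E (b 1) = -b 1 := by
  obtain ⟨x, hx⟩ := exists_conjugation_ne (F := F) hE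
  have h2' := two_ne_zero_ext (E := E) h2
  set d := conjugation F E x - x with hd
  have hd0 : d ≠ 0 := sub_ne_zero.2 hx
  have hdc : conjugation F E d = -d := by
    rw [hd, map_sub, conjugation_conjugation hE]
    ring
  have hli : LinearIndependent F ![(1 : E), d] := by
    rw [LinearIndependent.pair_iff' one_ne_zero]
    intro a ha
    have h1 : conjugation F E d = d := by
      rw [← ha, map_smul, conjugation_one]
    rw [hdc] at h1
    have h3 : 2 * d = 0 := by linear_combination -h1
    exact hd0 ((mul_eq_zero.1 h3).resolve_left h2')
  let b := basisOfLinearIndependentOfCardEqFinrank hli (by simp [hE])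
  refine ⟨b, by simp [b], by simpa [b] using hdc⟩

/-- Multiplication by a nonzero element of `E`, as an `F`-linear map. -/
def mulEquiv (F : Type*) {E : Type*} [Field F] [Field E] [Algebra F E] (u : E) (hu : u ≠ 0) :
    E ≃ₗ[F] E :=
  (LinearEquiv.smulOfNeZero E E u hu).restrictScalars F

lemma mulEquiv_apply (u : E) (hu : u ≠ 0) (x : E) : mulEquiv F u hu x = u * x := rfl

lemma ne_zero_of_mul_conjugation {u : E} (hu : u * conjugation F E u = 1) : u ≠ 0 := by
  rintro rfl
  simp at hu

lemma normForm_mul (hE : Module.finrank F E = 2) {u : E} {c : F}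
    (hu : u * conjugation F E u = algebraMap F E c) (x y : E) :
    normForm F E (u * x) (u * y) = c * normForm F E x y := by
  apply (algebraMap F E).injective
  rw [map_mul (algebraMap F E), algebraMap_normForm' hE, algebraMap_normForm' hE, conjugation_mul,
    conjugation_mul]
  linear_combination (2⁻¹ * (x * conjugation F E y + conjugation F E x * y)) * hu

/-- The rotation `x ↦ u x`, for `u` of norm one. -/
def normOneMul (hE : Module.finrank F E = 2) (u : E) (hu : u * conjugation F E u = 1) : OE F E :=
  ⟨mulEquiv F u (ne_zero_of_mul_conjugation hu), fun x y => by
    have := normForm_mul (c := 1) hE (by rw [hu, map_one]) x y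
    rwa [one_mul] at this⟩

/-- The conjugation as an element of `O(E)`. -/
def conjOE (hE : Module.finrank F E = 2) : OE F E := ⟨conjugation F E, conjugation_mem hE⟩

/-- Every element of `O(E)` is a rotation or a rotation composed with the conjugation. -/
lemma OE_cases (h2 : (2 : F) ≠ 0) (hE : Module.finrank F E = 2) (t : OE F E) :
    ∃ (u : E) (hu : u * conjugation F E u = 1),
      t = normOneMul hE u hu ∨ t = normOneMul hE u hu * conjOE hE := by
  obtain ⟨b, hb0, hb1⟩ := exists_basis_one_trace_zero h2 hE
  have h2' := two_ne_zero_ext (E := E) h2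
  have hN : ∀ x y, algebraMap F E (normForm F E (t.1 x) (t.1 y)) =
      algebraMap F E (normForm F E x y) :=
    fun x y => congrArg _ (t.2 x y)
  have hu : t.1 1 * conjugation F E (t.1 1) = 1 := by
    have := hN 1 1
    rwa [algebraMap_normForm_self h2 hE, algebraMap_normForm_self h2 hE, conjugation_one,
      one_mul] at this
  have hu0 := ne_zero_of_mul_conjugation hu
  set u := t.1 1 with hu_def
  have e1 := hN (b 1) (b 1)
  have e2 := hN (b 1) 1
  rw [algebraMap_normForm_self h2 hE, algebraMap_normForm_self h2 hE, hb1] at e1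
  rw [algebraMap_normForm' hE, algebraMap_normForm' hE, hb1, conjugation_one, ← hu_def] at e2
  set y := t.1 (b 1)
  have e2' : y * conjugation F E u + conjugation F E y * u = 0 := by
    have := e2
    field_simp at this
    linear_combination this
  -- `y u⁻¹` has trace zero and the same norm as `b 1`
  have e3 : (y - u * b 1) * (y + u * b 1) = 0 := by
    have e4 : y = -u * u * conjugation F E y := by
      linear_combination u * e2' - y * hu
    linear_combination y * e4 - u * u * e1
  refine ⟨u, hu, ?_⟩
  rcases mul_eq_zero.1 e3 with h | h
  · left
    apply Subtype.ext
    apply LinearEquiv.toLinearMap_injective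
    refine b.ext fun i => ?_
    fin_cases i
    · change t.1 (b 0) = u * b 0
      rw [hb0, mul_one]
    · change t.1 (b 1) = u * b 1
      exact sub_eq_zero.1 h
  · right
    apply Subtype.ext
    apply LinearEquiv.toLinearMap_injective
    refine b.ext fun i => ?_
    fin_cases i
    · change t.1 (b 0) = u * conjugation F E (b 0)
      rw [hb0, conjugation_one, mul_one]
    · change t.1 (b 1) = u * conjugation F E (b 1)
      rw [hb1]
      linear_combination h

lemma det_normOneMul (hE : Module.finrank F E = 2) (u : E) (hu : u * conjugation F E u = 1) :
    LinearMap.det (normOneMul hE u hu).1.toLinearMap = 1 := by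
  have h1 : LinearMap.det (normOneMul hE u hu).1.toLinearMap = Algebra.norm F u := rfl
  rw [h1]
  apply (algebraMap F E).injective
  have : Finite E := Module.finite_of_finite F
  rw [FiniteField.algebraMap_norm_eq_prod_pow, hE]
  simpa [Finset.prod_range_succ] using hu

lemma det_conjOE (h2 : (2 : F) ≠ 0) (hE : Module.finrank F E = 2) :
    LinearMap.det (conjOE (F := F) (E := E) hE).1.toLinearMap = -1 := by
  obtain ⟨b, hb0, hb1⟩ := exists_basis_one_trace_zero h2 hE
  have e0 : conjugation F E (b 0) = b 0 := by rw [hb0, conjugation_one]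
  rw [← LinearMap.det_toMatrix b, Matrix.det_fin_two]
  change LinearMap.toMatrix b b (conjugation F E).toLinearMap 0 0 *
    LinearMap.toMatrix b b (conjugation F E).toLinearMap 1 1 -
    LinearMap.toMatrix b b (conjugation F E).toLinearMap 0 1 *
    LinearMap.toMatrix b b (conjugation F E).toLinearMap 1 0 = -1
  simp only [LinearMap.toMatrix_apply, LinearEquiv.coe_coe, e0, hb1]
  simp

lemma det_OE_mul (s t : OE F E) : LinearMap.det (s * t).1.toLinearMap =
    LinearMap.det s.1.toLinearMap * LinearMap.det t.1.toLinearMap :=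
  LinearMap.det_comp s.1.toLinearMap t.1.toLinearMap

lemma det_OE (h2 : (2 : F) ≠ 0) (hE : Module.finrank F E = 2) (t : OE F E) :
    LinearMap.det t.1.toLinearMap = 1 ∨ LinearMap.det t.1.toLinearMap = -1 := by
  obtain ⟨u, hu, rfl | rfl⟩ := OE_cases h2 hE t
  · exact Or.inl (det_normOneMul hE u hu)
  · right
    rw [det_OE_mul, det_normOneMul, det_conjOE h2, one_mul]

lemma signOE_one : signOE (1 : OE F E) = 1 := by
  rw [signOE, if_pos]
  exact LinearMap.det_id

lemma signOE_mul (h2 : (2 : F) ≠ 0) (hE : Module.finrank F E = 2) (s t : OE F E) :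
    signOE (s * t) = signOE s * signOE t := by
  have hne : (-1 : F) ≠ 1 := by
    intro h
    apply h2
    linear_combination -h
  rw [signOE, signOE, signOE, det_OE_mul]
  rcases det_OE h2 hE s with hs | hs <;> rcases det_OE h2 hE t with ht | ht <;>
    simp [hs, ht, hne]

lemma signOE_conjOE (h2 : (2 : F) ≠ 0) (hE : Module.finrank F E = 2) :
    signOE (conjOE (F := F) (E := E) hE) = -1 := by
  have hne : (-1 : F) ≠ 1 := by
    intro h
    apply h2
    linear_combination -h
  rw [signOE, det_conjOE h2, if_neg hne]

lemma signOE_mul_self (t : OE F E) : signOE t * signOE t = 1 := by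
  rw [signOE]
  split_ifs <;> simp

lemma signOE_eq_one_iff (t : OE F E) : signOE t = 1 ↔ LinearMap.det t.1.toLinearMap = 1 := by
  rw [signOE]
  split_ifs with h <;> simp [h]

lemma conjOE_mul_self (hE : Module.finrank F E = 2) :
    conjOE (F := F) (E := E) hE * conjOE hE = 1 := by
  apply Subtype.ext
  ext x
  exact conjugation_conjugation hE x

/-- The elements of `O(E)` outside `SO(E)` are involutions. -/
lemma normOneMul_mul_conjOE_sq (hE : Module.finrank F E = 2) (u : E)
    (hu : u * conjugation F E u = 1) :
    (normOneMul hE u hu * conjOE hE) * (normOneMul hE u hu * conjOE hE) = 1 := by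
  apply Subtype.ext
  ext x
  change u * conjugation F E (u * conjugation F E x) = x
  rw [conjugation_mul, conjugation_conjugation hE]
  linear_combination x * hu

/-- Every vector of `E` is fixed by a reflection. -/
lemma exists_reflection_fixing (h2 : (2 : F) ≠ 0) (hE : Module.finrank F E = 2) (e : E) :
    ∃ t : OE F E, t.1 e = e ∧ signOE t = -1 := by
  rcases eq_or_ne e 0 with rfl | he
  · exact ⟨conjOE hE, map_zero _, signOE_conjOE h2 hE⟩
  · have he' : conjugation F E e ≠ 0 := (LinearEquiv.map_ne_zero_iff _).2 he
    have hu : e / conjugation F E e * conjugation F E (e / conjugation F E e) = 1 := by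
      rw [div_eq_mul_inv, conjugation_mul, conjugation_inv, conjugation_conjugation hE]
      field_simp
    refine ⟨normOneMul hE _ hu * conjOE hE, ?_, ?_⟩
    · change e / conjugation F E e * conjugation F E e = e
      field_simp
    · rw [signOE_mul h2 hE, signOE_conjOE h2, (signOE_eq_one_iff _).2 (det_normOneMul hE _ hu),
        one_mul]

/-- A homomorphism that kills the involutions of `O(E)` is trivial. -/
lemma map_OE_eq_one {A : Type*} [CommMonoid A] (h2 : (2 : F) ≠ 0) (hE : Module.finrank F E = 2)
    (χ : OE F E →* A) (hχ : ∀ t : OE F E, t * t = 1 → χ t = 1) (t : OE F E) : χ t = 1 := by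
  obtain ⟨u, hu, rfl | rfl⟩ := OE_cases h2 hE t
  · have : normOneMul hE u hu = (normOneMul hE u hu * conjOE hE) * conjOE hE := by
      rw [mul_assoc, conjOE_mul_self, mul_one]
    rw [this, map_mul, hχ _ (normOneMul_mul_conjOE_sq hE u hu), hχ _ (conjOE_mul_self hE), one_mul]
  · exact hχ _ (normOneMul_mul_conjOE_sq hE u hu)

lemma exists_norm_eq_neg_one (hE : Module.finrank F E = 2) :
    ∃ e : E, e * conjugation F E e = algebraMap F E (-1) := by
  have : Finite E := Module.finite_of_finite F
  obtain ⟨e, he⟩ := FiniteField.norm_surjective F E (-1)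
  refine ⟨e, ?_⟩
  rw [← he, FiniteField.algebraMap_norm_eq_prod_pow, hE]
  simp [Finset.prod_range_succ]

end NormForm

namespace PolarizedSymplecticSpace

section WeilScalar

variable {F E V K : Type*} [Field F] [Fintype F] [Field E] [Algebra F E] [FiniteDimensional F E]
  [AddCommGroup V] [Module F V] [FiniteDimensional F V] [Field K]
  (S : PolarizedSymplecticSpace F V)

/-! ### Triviality of the scalars of the Weil representation on the dual pair -/

lemma tmul_mem_tensorSubspace {N : Submodule F V} {x : V} (hx : x ∈ N) (e : E) :
    x ⊗ₜ[F] e ∈ tensorSubspace E N :=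
  ⟨(⟨x, hx⟩ : N) ⊗ₜ e, rfl⟩

lemma tensorSubspace_le {N : Submodule F V} {W : Submodule F (V ⊗[F] E)}
    (h : ∀ x ∈ N, ∀ e : E, x ⊗ₜ[F] e ∈ W) : tensorSubspace E N ≤ W := by
  rintro _ ⟨y, rfl⟩
  induction y with
  | zero => simp
  | add a b ha hb => rw [map_add]; exact add_mem ha hb
  | tmul x e => exact h x x.2 e

lemma congr_mem_tensorSubspace {N N' : Submodule F V} {g : V ≃ₗ[F] V} (t : E ≃ₗ[F] E)
    (h : ∀ x ∈ N, g x ∈ N') {w : V ⊗[F] E} (hw : w ∈ tensorSubspace E N) :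
    TensorProduct.congr g t w ∈ tensorSubspace E N' := by
  have : tensorSubspace E N ≤ (tensorSubspace E N').comap (TensorProduct.congr g t).toLinearMap :=
    tensorSubspace_le fun x hx e => tmul_mem_tensorSubspace (h x hx) (t e)
  exact this hw

variable (h2 : (2 : F) ≠ 0) (hE : Module.finrank F E = 2)

lemma dualPair_apply (p : S.Sp × OE F E) (x : V ⊗[F] E) :
    (S.dualPair h2 hE p).1 x = TensorProduct.congr p.1.1 p.2.1 x := rfl

lemma dualPair_mem_siegelParabolic {g : S.Sp} (hg : g ∈ S.siegelParabolic) (t : OE F E) :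
    S.dualPair h2 hE (g, t) ∈ (S.tensor h2 hE).siegelParabolic :=
  (S.tensor h2 hE).mem_siegelParabolic_of_forall fun _ hw =>
    congr_mem_tensorSubspace t.1 (fun _ hx => S.apply_mem_L hg hx) hw

lemma dualPair_mem_levi {g : S.Sp} (hg : g ∈ S.levi) (t : OE F E) :
    S.dualPair h2 hE (g, t) ∈ (S.tensor h2 hE).levi :=
  (S.tensor h2 hE).mem_levi_of_forall
    (fun _ hw => congr_mem_tensorSubspace t.1 (fun _ hx => S.apply_mem_L hg.1 hx) hw)
    (fun _ hw => congr_mem_tensorSubspace t.1 (fun _ hx => S.apply_mem_L' hg hx) hw)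

/-- The identification of `L ⊗ E` with the Lagrangian subspace of `V ⊗ E`. -/
def tensorLEquiv : (S.L ⊗[F] E) ≃ₗ[F] (S.tensor (E := E) h2 hE).L :=
  LinearEquiv.ofInjective (S.L.subtype.rTensor E)
    (Module.Flat.rTensor_preserves_injective_linearMap _ S.L.injective_subtype)

lemma coe_tensorLEquiv (y : S.L ⊗[F] E) :
    (S.tensorLEquiv h2 hE y : V ⊗[F] E) = S.L.subtype.rTensor E y := rfl

lemma dualPair_eq_leviOf {g : S.Sp} (hg : g ∈ S.levi) (t : OE F E) :
    S.dualPair h2 hE (g, t) = (S.tensor h2 hE).leviOf ((S.tensorLEquiv h2 hE).autConj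
      (TensorProduct.congr (S.restrictL g (S.levi_le hg)) t.1)) := by
  refine (S.tensor h2 hE).levi_ext (S.dualPair_mem_levi h2 hE hg t)
    ((S.tensor h2 hE).leviOf_mem _) fun a ha => ?_
  obtain ⟨y, hy⟩ := (S.tensorLEquiv h2 hE).surjective ⟨a, ha⟩
  have ha' : a = S.tensorLEquiv h2 hE y := by rw [hy]
  rw [ha', leviOf_apply_L, dualPair_apply]
  simp only [LinearEquiv.autConj, MonoidHom.coe_mk, OneHom.coe_mk, LinearEquiv.trans_apply,
    LinearEquiv.symm_apply_apply, coe_tensorLEquiv]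
  have : (TensorProduct.congr g.1 t.1).toLinearMap ∘ₗ S.L.subtype.rTensor E =
      S.L.subtype.rTensor E ∘ₗ
        (TensorProduct.congr (S.restrictL g (S.levi_le hg)) t.1).toLinearMap := by
    ext x e
    rfl
  exact LinearMap.congr_fun this y

variable {ψ : AddChar F K} (hψ : ψ ≠ 1)
  {ω : Representation K (S.tensor (E := E) h2 hE).Sp ((S.tensor (E := E) h2 hE).L' → K)}
  (hω : (S.tensor h2 hE).IsWeil ψ ω)

/-- The scalars of the Weil representation, as a character of `GL(L ⊗ E)`. -/
def weilScalarGL : ((S.L ⊗[F] E) ≃ₗ[F] (S.L ⊗[F] E)) →* K :=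
  ((S.tensor h2 hE).weilScalarHom hψ hω).comp
    (MonoidHom.mk' (fun h => ⟨(S.tensor h2 hE).leviOf ((S.tensorLEquiv h2 hE).autConj h),
      ((S.tensor h2 hE).leviOf_mem _).1⟩) fun h k => by
        apply Subtype.ext
        change (S.tensor h2 hE).leviOf _ = (S.tensor h2 hE).leviOf _ * (S.tensor h2 hE).leviOf _
        rw [map_mul, leviOf_mul])

lemma weilScalar_dualPair_levi {g : S.Sp} (hg : g ∈ S.levi) (t : OE F E) :
    (S.tensor h2 hE).weilScalar ω (S.dualPair h2 hE (g, t)) =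
      S.weilScalarGL h2 hE hψ hω (TensorProduct.congr (S.restrictL g (S.levi_le hg)) t.1) := by
  rw [S.dualPair_eq_leviOf h2 hE hg]
  rfl

include hψ hω in
/-- The group `O(E)` acts without scalars, because `L` is a plane. -/
lemma weilScalar_OE (hL : Module.finrank F S.L = 2) (t : OE F E) :
    (S.tensor h2 hE).weilScalar ω (S.dualPair h2 hE (1, t)) = 1 := by
  let χ : OE F E →* K := ((S.tensor h2 hE).weilScalarHom hψ hω).comp
    (((S.dualPair h2 hE).comp (MonoidHom.inr S.Sp (OE F E))).codRestrict _
      fun t => S.dualPair_mem_siegelParabolic h2 hE (one_mem _) t)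
  refine map_OE_eq_one h2 hE χ (fun t ht => ?_) t
  change (S.tensor h2 hE).weilScalar ω (S.dualPair h2 hE (1, t)) = 1
  rw [S.weilScalar_dualPair_levi h2 hE hψ hω (one_mem _)]
  exact map_refl_congr_eq_one hL (S.weilScalarGL h2 hE hψ hω) t.1 (congrArg Subtype.val ht)

include hψ hω in
/-- Involutions in `M₁` act without scalars, because `E` is a plane. -/
lemma weilScalar_levi_involution {g : S.Sp} (hg : g ∈ S.levi) (hgg : g * g = 1) :
    (S.tensor h2 hE).weilScalar ω (S.dualPair h2 hE (g, 1)) = 1 := by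
  rw [S.weilScalar_dualPair_levi h2 hE hψ hω hg]
  refine map_congr_refl_eq_one hE (S.weilScalarGL h2 hE hψ hω) _ ?_
  ext x
  exact LinearEquiv.congr_fun (congrArg Subtype.val hgg) x

lemma apply_sub_mem_L {u : S.Sp} (hu : u ∈ S.unipotentRadical) (x : V) : u.1 x - x ∈ S.L := by
  rw [← S.lagrangian]
  intro a ha
  change S.form a (u.1 x - x) = 0
  have := u.2 a x
  rw [hu a ha] at this
  rw [map_sub, this, sub_self]

lemma unipotentRadical_pow_apply {u : S.Sp} (hu : u ∈ S.unipotentRadical) (n : ℕ) (x : V) :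
    (u ^ n).1 x = x + n • (u.1 x - x) := by
  induction n with
  | zero => simp
  | succ n ih =>
    rw [pow_succ']
    change u.1 ((u ^ n).1 x) = _
    rw [ih, map_add, map_nsmul, hu _ (S.apply_sub_mem_L hu x), succ_nsmul]
    abel

lemma unipotentRadical_inv_apply {u : S.Sp} (hu : u ∈ S.unipotentRadical) (x : V) :
    (u⁻¹).1 x = x - (u.1 x - x) := by
  change u.1.symm x = _
  rw [LinearEquiv.symm_apply_eq, map_sub, hu _ (S.apply_sub_mem_L hu x)]
  abel

lemma unipotentRadical_pow_card {u : S.Sp} (hu : u ∈ S.unipotentRadical) :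
    u ^ Fintype.card F = 1 := by
  apply Subtype.ext
  ext x
  rw [S.unipotentRadical_pow_apply hu, ← Nat.cast_smul_eq_nsmul F, FiniteField.cast_card_eq_zero,
    zero_smul, add_zero]
  rfl

/-- The similitude of factor `-1` that is `-1` on `L` and `1` on `L'`. -/
def negL : V ≃ₗ[F] V :=
  LinearEquiv.ofInvolutive (S.L'.subtype ∘ₗ S.snd - S.L.subtype ∘ₗ S.fst) fun x => by
    simpa [add_comm] using S.fst_add_snd x

lemma negL_apply (x : V) : S.negL x = S.snd x - S.fst x := rfl

lemma form_negL (x y : V) : S.form (S.negL x) (S.negL y) = - S.form x y := by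
  rw [S.form_eq x y, negL_apply, negL_apply]
  simp only [map_sub, LinearMap.sub_apply, form_LL, form_LL']
  rw [S.form_swap (S.snd x)]
  ring

include hψ hω in
/-- The unipotent radical `U₁` acts without scalars: for `e ∈ E` of norm `-1`, the tensor product
of `negL` with the multiplication by `e` conjugates `u ⊗ 1` to its inverse, so the scalar of `u`
has order dividing `2`, and it also has odd order. -/
lemma weilScalar_unipotentRadical {u : S.Sp} (hu : u ∈ S.unipotentRadical) :
    (S.tensor h2 hE).weilScalar ω (S.dualPair h2 hE (u, 1)) = 1 := by
  obtain ⟨e, he⟩ := exists_norm_eq_neg_one (F := F) hE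
  have he0 : e ≠ 0 := by
    rintro rfl
    simp at he
  let m : (S.tensor (E := E) h2 hE).Sp := ⟨TensorProduct.congr S.negL (mulEquiv F e he0), by
    have : (S.form.tmul (normForm F E)).compl₁₂
        (TensorProduct.congr S.negL (mulEquiv F e he0)).toLinearMap
        (TensorProduct.congr S.negL (mulEquiv F e he0)).toLinearMap =
        S.form.tmul (normForm F E) := by
      ext v x w y
      simp [S.form_negL v w, mulEquiv_apply, normForm_mul hE he]
    exact fun x y => LinearMap.congr_fun₂ this x y⟩
  have hm : m ∈ (S.tensor h2 hE).siegelParabolic :=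
    (S.tensor h2 hE).mem_siegelParabolic_of_forall fun _ hw =>
      congr_mem_tensorSubspace _ (fun x hx => by
        rw [negL_apply, (S.snd_eq_zero_iff x).2 hx, Submodule.coe_zero, zero_sub]
        exact neg_mem (Subtype.mem _)) hw
  have hu' := S.unipotentRadical_le hu
  have hconj : m * S.dualPair h2 hE (u, 1) = S.dualPair h2 hE (u⁻¹, 1) * m := by
    apply Subtype.ext
    apply LinearEquiv.toLinearMap_injective
    ext x y
    change S.negL (u.1 x) ⊗ₜ[F] (e * y) = (u⁻¹).1 (S.negL x) ⊗ₜ[F] (e * y)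
    congr 1
    have h1 : S.negL (u.1 x - x) = -(u.1 x - x) := by
      rw [negL_apply, (S.snd_eq_zero_iff _).2 (S.apply_sub_mem_L hu x),
        S.fst_of_mem (S.apply_sub_mem_L hu x)]
      simp
    have h3 : u.1 (S.negL x) - S.negL x = u.1 x - x := by
      rw [negL_apply, map_sub, hu _ (S.fst x).2]
      conv_rhs => rw [← S.fst_add_snd x, map_add, hu _ (S.fst x).2]
      abel
    rw [S.unipotentRadical_inv_apply hu, h3, ← sub_eq_zero]
    rw [map_sub] at h1
    rw [sub_eq_iff_eq_add] at h1
    rw [h1]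
    abel
  have hD := fun g (hg : g ∈ S.siegelParabolic) => S.dualPair_mem_siegelParabolic h2 hE hg 1
  let χ := (S.tensor h2 hE).weilScalarHom hψ hω
  let u' : (S.tensor (E := E) h2 hE).siegelParabolic := ⟨S.dualPair h2 hE (u, 1), hD _ hu'⟩
  have hinv : (⟨S.dualPair h2 hE (u⁻¹, 1), hD _ (inv_mem hu')⟩ :
      (S.tensor (E := E) h2 hE).siegelParabolic) = u'⁻¹ := by
    rw [eq_inv_iff_mul_eq_one]
    apply Subtype.ext
    change S.dualPair h2 hE (u⁻¹, 1) * S.dualPair h2 hE (u, 1) = 1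
    rw [← map_mul, ← map_one (S.dualPair h2 hE)]
    congr 1
    simp
  have hm' : (⟨m, hm⟩ : (S.tensor (E := E) h2 hE).siegelParabolic) * u' = u'⁻¹ * ⟨m, hm⟩ := by
    rw [← hinv]
    exact Subtype.ext hconj
  have hm0 : χ ⟨m, hm⟩ ≠ 0 := by
    intro h
    have := map_mul χ ⟨m, hm⟩ ⟨m, hm⟩⁻¹
    rw [mul_inv_cancel, map_one, h, zero_mul] at this
    exact one_ne_zero this
  have h1 : χ u' = χ u'⁻¹ := by
    have := congrArg χ hm'
    rw [map_mul, map_mul, mul_comm] at this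
    exact mul_right_cancel₀ hm0 this
  have hsq : χ u' ^ 2 = 1 := by
    rw [pow_two]
    nth_rewrite 2 [h1]
    rw [← map_mul, mul_inv_cancel, map_one]
  have hodd : χ u' ^ Fintype.card F = 1 := by
    rw [← map_pow, ← map_one χ]
    congr 1
    apply Subtype.ext
    change (S.dualPair h2 hE (u, 1)) ^ Fintype.card F = 1
    rw [← map_pow, Prod.pow_mk, S.unipotentRadical_pow_card hu, one_pow]
    exact map_one _
  have hcop : Nat.Coprime 2 (Fintype.card F) := by
    rw [Nat.coprime_two_left, Nat.odd_iff]
    apply FiniteField.odd_card_of_char_ne_two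
    intro h
    apply h2
    have := ringChar.Nat.cast_ringChar (R := F)
    rw [h] at this
    exact_mod_cast this
  exact (pow_eq_one_iff_of_coprime hcop).1 ⟨hsq, hodd⟩

end WeilScalar

end PolarizedSymplecticSpace

namespace PolarizedSymplecticSpace

section Hat

variable {F E V K : Type*} [Field F] [Fintype F] [Field E] [Algebra F E] [FiniteDimensional F E]
  [AddCommGroup V] [Module F V] [FiniteDimensional F V] [Field K]
  (S : PolarizedSymplecticSpace F V)

/-! ### Vectors of `L' ⊗ E` as maps `L → E` -/

/-- The map `V ⊗ E → Hom(L, E)` sending `x ⊗ e` to `a ↦ ⟨a, x⟩ e`. -/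
def hat : V ⊗[F] E →ₗ[F] (S.L →ₗ[F] E) :=
  TensorProduct.lift <| LinearMap.mk₂ F
    (fun x e => (S.form.flip x ∘ₗ S.L.subtype).smulRight e)
    (fun x y e => by ext a; simp [add_smul])
    (fun c x e => by ext a; simp [mul_smul])
    (fun x e f => by ext a; simp)
    (fun c x e => by ext a; exact smul_comm _ _ _)

lemma hat_tmul (x : V) (e : E) (a : S.L) : S.hat (x ⊗ₜ[F] e) a = S.form a x • e := rfl

lemma hat_congr {g : S.Sp} (hg : g ∈ S.siegelParabolic) (t : E ≃ₗ[F] E) (v : V ⊗[F] E)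
    (a : S.L) :
    S.hat (TensorProduct.congr g.1 t v) (S.restrictL g hg a) = t (S.hat v a) := by
  have : (LinearMap.applyₗ (S.restrictL g hg a) ∘ₗ S.hat) ∘ₗ
      (TensorProduct.congr g.1 t).toLinearMap = t.toLinearMap ∘ₗ LinearMap.applyₗ a ∘ₗ S.hat := by
    ext x e
    have h := g.2 a x
    simp [hat_tmul, coe_restrictL, h]
  exact LinearMap.congr_fun this v

lemma hat_congr_one (t : E ≃ₗ[F] E) (v : V ⊗[F] E) (a : S.L) :
    S.hat (TensorProduct.congr (LinearEquiv.refl F V) t v) a = t (S.hat v a) :=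
  S.hat_congr (g := 1) (one_mem _) t v a

/-- Coordinates on `L` given by a basis of `L'`. -/
def dualCoord (b : Module.Basis (Fin 2) F S.L') : S.L ≃ₗ[F] (Fin 2 → F) :=
  LinearEquiv.ofInjectiveOfFinrankEq
    (LinearMap.pi fun i => S.form.flip (b i) ∘ₗ S.L.subtype)
    (by
      rw [injective_iff_map_eq_zero]
      intro a ha
      by_contra hne
      obtain ⟨w, hw⟩ := S.exists_form_ne' hne
      apply hw
      have h1 : S.form a ∘ₗ S.L'.subtype = 0 := b.ext fun i => congrFun ha i
      exact LinearMap.congr_fun h1 w)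
    (by rw [S.finrank_L_eq, Module.finrank_eq_card_basis b]; simp)

lemma dualCoord_apply (b : Module.Basis (Fin 2) F S.L') (a : S.L) (i : Fin 2) :
    S.dualCoord b a i = S.form a (b i) := rfl

lemma exists_eq_tmul_add_tmul (b : Module.Basis (Fin 2) F S.L') {v : V ⊗[F] E}
    (hv : v ∈ tensorSubspace E S.L') :
    ∃ e f : E, v = (b 0 : V) ⊗ₜ[F] e + (b 1 : V) ⊗ₜ[F] f := by
  let φ : E × E →ₗ[F] V ⊗[F] E :=
    (TensorProduct.mk F V E (b 0)).coprod (TensorProduct.mk F V E (b 1))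
  have hle : tensorSubspace E S.L' ≤ LinearMap.range φ := by
    refine tensorSubspace_le fun x hx e => ⟨(b.repr ⟨x, hx⟩ 0 • e, b.repr ⟨x, hx⟩ 1 • e), ?_⟩
    have h := congrArg Subtype.val (b.sum_repr ⟨x, hx⟩)
    simp only [Fin.sum_univ_two, Submodule.coe_add, Submodule.coe_smul] at h
    conv_rhs => rw [← h]
    simp [φ, TensorProduct.add_tmul, TensorProduct.smul_tmul]
  obtain ⟨⟨e, f⟩, h⟩ := hle hv
  exact ⟨e, f, h.symm⟩

variable (hL : Module.finrank F S.L = 2)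

lemma hat_sum (b : Module.Basis (Fin 2) F S.L') (e f : E) (a : S.L) :
    S.hat ((b 0 : V) ⊗ₜ[F] e + (b 1 : V) ⊗ₜ[F] f) a =
      S.dualCoord b a 0 • e + S.dualCoord b a 1 • f := by
  simp [hat_tmul, dualCoord_apply]

include hL in
lemma exists_basis_L' : Nonempty (Module.Basis (Fin 2) F S.L') :=
  ⟨Module.finBasisOfFinrankEq F S.L' (by rw [← S.finrank_L_eq, hL])⟩

include hL in
/-- A vector of `L' ⊗ E` is determined by the corresponding map `L → E`. -/
lemma hat_injective {v w : V ⊗[F] E} (hv : v ∈ tensorSubspace E S.L')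
    (hw : w ∈ tensorSubspace E S.L') (h : ∀ a, S.hat v a = S.hat w a) : v = w := by
  obtain ⟨b⟩ := S.exists_basis_L' hL
  obtain ⟨e, f, h1⟩ := S.exists_eq_tmul_add_tmul b (sub_mem hv hw)
  have h0 : ∀ a, S.hat (v - w) a = 0 := fun a => by
    rw [map_sub, LinearMap.sub_apply, h, sub_self]
  have he := h0 ((S.dualCoord b).symm ![1, 0])
  have hf := h0 ((S.dualCoord b).symm ![0, 1])
  rw [h1, hat_sum, LinearEquiv.apply_symm_apply] at he hf
  have he : e = 0 := by simpa using he
  have hf : f = 0 := by simpa using hf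
  rw [← sub_eq_zero, h1, he, hf]
  simp

/-- An indecomposable vector `v` corresponds to an injective map `L → E`: a linear relation
between its coordinates on a basis of `L'` would decompose it. -/
lemma hat_injective_of_indecomposable (hL : Module.finrank F S.L = 2) {v : V ⊗[F] E}
    (hv : v ∈ S.indecomposable E) : Function.Injective (S.hat v) := by
  obtain ⟨b⟩ := S.exists_basis_L' hL
  obtain ⟨e, f, rfl⟩ := S.exists_eq_tmul_add_tmul b hv.1
  rw [injective_iff_map_eq_zero]
  intro a ha
  rw [hat_sum] at ha
  set s := S.dualCoord b a 0 with hs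
  set t := S.dualCoord b a 1 with ht
  have hs0 : s = 0 := by
    by_contra hs0
    have he : e = (-(s⁻¹ * t)) • f := by
      have := congrArg (s⁻¹ • ·) ha
      simp only [smul_add, smul_smul, inv_mul_cancel₀ hs0, one_smul, smul_zero] at this
      rw [neg_smul]
      exact eq_neg_of_add_eq_zero_left this
    refine hv.2 ((-(s⁻¹ * t)) • b 0 + b 1 : S.L') (Subtype.mem _) f ?_
    rw [he, Submodule.coe_add, Submodule.coe_smul, TensorProduct.add_tmul, TensorProduct.smul_tmul]
  have ht0 : t = 0 := by
    by_contra ht0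
    rw [hs0, zero_smul, zero_add] at ha
    have hf : f = 0 := (smul_eq_zero.1 ha).resolve_left ht0
    refine hv.2 (b 0) (Subtype.mem _) e ?_
    rw [hf]
    simp
  rw [← (S.dualCoord b).map_eq_zero_iff]
  ext i
  fin_cases i
  · exact hs0
  · exact ht0

variable (hE : Module.finrank F E = 2)

/-- The isomorphism `L ≃ E` attached to an indecomposable vector of `L' ⊗ E`. -/
def hatEquiv {v : V ⊗[F] E} (hv : v ∈ S.indecomposable E) : S.L ≃ₗ[F] E :=
  LinearEquiv.ofInjectiveOfFinrankEq (S.hat v) (S.hat_injective_of_indecomposable hL hv)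
    (by rw [hL, hE])

lemma hatEquiv_apply {v : V ⊗[F] E} (hv : v ∈ S.indecomposable E) (a : S.L) :
    S.hatEquiv hL hE hv a = S.hat v a := rfl

include hL hE in
lemma indecomposable_nonempty : (S.indecomposable E).Nonempty := by
  obtain ⟨b⟩ := S.exists_basis_L' hL
  let c := Module.finBasisOfFinrankEq F E hE
  refine ⟨(b 0 : V) ⊗ₜ[F] c 0 + (b 1 : V) ⊗ₜ[F] c 1,
    add_mem (tmul_mem_tensorSubspace (b 0).2 _) (tmul_mem_tensorSubspace (b 1).2 _), ?_⟩
  intro x _ e h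
  have hinj : Function.Injective (S.form.flip x ∘ₗ S.L.subtype) := by
    rw [injective_iff_map_eq_zero]
    intro a ha
    have h1 : S.hat (x ⊗ₜ[F] e) a = 0 := by
      have : S.form a x = 0 := ha
      rw [hat_tmul, this, zero_smul]
    rw [← h, hat_sum] at h1
    have h3 := LinearIndependent.pair_iff.1 (show LinearIndependent F ![c 0, c 1] by
      convert c.linearIndependent using 1
      ext i
      fin_cases i <;> rfl) _ _ h1
    rw [← (S.dualCoord b).map_eq_zero_iff]
    ext i
    fin_cases i
    · exact h3.1
    · exact h3.2
  have := LinearMap.finrank_le_finrank_of_injective hinj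
  rw [hL, Module.finrank_self] at this
  omega

lemma congr_mem_indecomposable {g : S.Sp} (hg : g ∈ S.levi) (t : E ≃ₗ[F] E) {v : V ⊗[F] E}
    (hv : v ∈ S.indecomposable E) : TensorProduct.congr g.1 t v ∈ S.indecomposable E := by
  refine ⟨congr_mem_tensorSubspace t (fun x hx => S.apply_mem_L' hg hx) hv.1, fun x hx e h => ?_⟩
  refine hv.2 (g⁻¹.1 x) (S.apply_mem_L' (inv_mem hg) hx) (t.symm e) ?_
  rw [← (TensorProduct.congr g.1 t).symm_apply_apply v, h]
  rfl

include hL hE in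
/-- The Levi subgroup acts transitively on the indecomposable vectors. -/
lemma exists_levi_congr_eq {v w : V ⊗[F] E} (hv : v ∈ S.indecomposable E)
    (hw : w ∈ S.indecomposable E) :
    ∃ m ∈ S.levi, TensorProduct.congr m.1 (LinearEquiv.refl F E) v = w := by
  let h := (S.hatEquiv hL hE hv).trans (S.hatEquiv hL hE hw).symm
  have hm := S.leviOf_mem h
  refine ⟨S.leviOf h, hm, S.hat_injective hL (S.congr_mem_indecomposable hm _ hv).1 hw.1 ?_⟩
  intro a
  obtain ⟨a, rfl⟩ := h.surjective a
  have e : h a = S.restrictL (S.leviOf h) (S.levi_le hm) a := by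
    apply Subtype.ext
    rw [coe_restrictL, leviOf_apply_L]
  conv_lhs => rw [e, hat_congr]
  rw [← S.hatEquiv_apply hL hE hw]
  simp [h, hatEquiv_apply]

include hL in
/-- `O(E)` acts freely on the indecomposable vectors. -/
lemma eq_of_congr_eq (hE : Module.finrank F E = 2) {v : V ⊗[F] E} (hv : v ∈ S.indecomposable E)
    {s t : E ≃ₗ[F] E}
    (h : TensorProduct.congr (LinearEquiv.refl F V) s v =
      TensorProduct.congr (LinearEquiv.refl F V) t v) : s = t := by
  ext x
  obtain ⟨a, rfl⟩ := (S.hatEquiv hL hE hv).surjective x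
  rw [hatEquiv_apply, ← hat_congr_one, h, hat_congr_one]

/-! ### The characters of the unipotent radical -/

/-- The unipotent element `x ↦ x + c (⟨a, x⟩ a' + ⟨a', x⟩ a)`, for `a, a' ∈ L`. -/
def unipotent (a a' : S.L) (c : F) : S.Sp :=
  have key : ∀ (c : F) (x : V), S.form a (c • (S.form a x • (a' : V) + S.form a' x • (a : V))) = 0 ∧
      S.form a' (c • (S.form a x • (a' : V) + S.form a' x • (a : V))) = 0 := fun c x => by
    simp [form_LL]
  ⟨LinearEquiv.ofLinearMap
    (LinearMap.id + c • ((S.form a).smulRight (a' : V) + (S.form a').smulRight (a : V)))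
    (LinearMap.id + (-c) • ((S.form a).smulRight (a' : V) + (S.form a').smulRight (a : V)))
    (by
      ext x
      simp only [LinearMap.comp_apply, LinearMap.add_apply, LinearMap.id_apply,
        LinearMap.smul_apply, LinearMap.smulRight_apply, map_add, (key (-c) x).1, (key (-c) x).2]
      module)
    (by
      ext x
      simp only [LinearMap.comp_apply, LinearMap.add_apply, LinearMap.id_apply,
        LinearMap.smul_apply, LinearMap.smulRight_apply, map_add, (key c x).1, (key c x).2]
      module), by
    intro x y
    simp only [LinearEquiv.coe_ofLinearMap, LinearMap.add_apply, LinearMap.id_apply,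
      LinearMap.smul_apply, LinearMap.smulRight_apply, map_add, map_smul, smul_eq_mul, form_LL]
    rw [S.form_swap x a, S.form_swap x a']
    ring⟩

lemma unipotent_apply (a a' : S.L) (c : F) (x : V) : (S.unipotent a a' c).1 x =
    x + c • (S.form a x • (a' : V) + S.form a' x • (a : V)) := rfl

lemma unipotent_mem (a a' : S.L) (c : F) : S.unipotent a a' c ∈ S.unipotentRadical := by
  intro x hx
  have h1 := S.form_LL a ⟨x, hx⟩
  have h2 := S.form_LL a' ⟨x, hx⟩
  simp only at h1 h2
  rw [unipotent_apply, h1, h2]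
  simp

lemma form_unipotent (a a' : S.L) (c : F) (v w : V ⊗[F] E) :
    S.form.tmul (normForm F E)
      (TensorProduct.congr (S.unipotent a a' c).1 (LinearEquiv.refl F E) v - v) w =
    c * (normForm F E (S.hat v a) (S.hat w a') + normForm F E (S.hat v a') (S.hat w a)) := by
  have : S.form.tmul (normForm F E) ∘ₗ
      ((TensorProduct.congr (S.unipotent a a' c).1 (LinearEquiv.refl F E)).toLinearMap -
        LinearMap.id) =
      c • ((normForm F E).compl₁₂ (LinearMap.applyₗ a ∘ₗ S.hat) (LinearMap.applyₗ a' ∘ₗ S.hat) +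
        (normForm F E).compl₁₂ (LinearMap.applyₗ a' ∘ₗ S.hat) (LinearMap.applyₗ a ∘ₗ S.hat)) := by
    ext x e y f
    simp [hat_tmul, unipotent_apply, TensorProduct.add_tmul]
    ring
  exact LinearMap.congr_fun₂ this v w

/-- On the elements `unipotent a a' c` the character `phi` reads off the pullback to `L` of the norm
form of `E` under `hat v`. -/
lemma phi_unipotent (h2 : (2 : F) ≠ 0) (hE : Module.finrank F E = 2) (ψ : AddChar F K)
    (a a' : S.L) (c : F) (v : V ⊗[F] E) :
    S.phi ψ v (S.unipotent a a' c) = ψ (c * normForm F E (S.hat v a) (S.hat v a')) := by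
  rw [phi, form_unipotent, normForm_comm hE (S.hat v a')]
  congr 1
  field_simp
  ring

include hL in
/-- The characters of `U₁` attached to indecomposable vectors in different `O(E)`-orbits are
different: they determine the pullback to `L` of the norm form of `E`. -/
lemma exists_congr_eq_of_phi_eq (h2 : (2 : F) ≠ 0) (hE : Module.finrank F E = 2) {ψ : AddChar F K}
    (hψ : ψ ≠ 1) {v w : V ⊗[F] E} (hv : v ∈ S.indecomposable E) (hw : w ∈ S.indecomposable E)
    (h : ∀ u ∈ S.unipotentRadical, S.phi ψ v u = S.phi ψ w u) :
    ∃ t : OE F E, w = TensorProduct.congr (LinearEquiv.refl F V) t.1 v := by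
  have hN : ∀ a a' : S.L, normForm F E (S.hat w a) (S.hat w a') =
      normForm F E (S.hat v a) (S.hat v a') := by
    intro a a'
    by_contra hne
    obtain ⟨c, hc⟩ := (AddChar.ne_one_iff).1 hψ
    rw [← Ne, ← sub_ne_zero] at hne
    have h1 := h _ (S.unipotent_mem a a' (c / (normForm F E (S.hat w a) (S.hat w a') -
      normForm F E (S.hat v a) (S.hat v a'))))
    rw [S.phi_unipotent h2 hE, S.phi_unipotent h2 hE] at h1
    apply hc
    have h3 : c = (c / (normForm F E (S.hat w a) (S.hat w a') -
      normForm F E (S.hat v a) (S.hat v a'))) * normForm F E (S.hat w a) (S.hat w a') -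
      (c / (normForm F E (S.hat w a) (S.hat w a') -
      normForm F E (S.hat v a) (S.hat v a'))) * normForm F E (S.hat v a) (S.hat v a') := by
      rw [← mul_sub, div_mul_cancel₀ _ hne]
    rw [h3, AddChar.map_sub_eq_div, ← h1, div_self]
    exact (AddChar.val_isUnit ψ _).ne_zero
  let t := (S.hatEquiv hL hE hv).symm.trans (S.hatEquiv hL hE hw)
  have ht : ∀ a, t (S.hat v a) = S.hat w a := fun a => by
    change S.hatEquiv hL hE hw ((S.hatEquiv hL hE hv).symm (S.hatEquiv hL hE hv a)) = _
    rw [LinearEquiv.symm_apply_apply, hatEquiv_apply]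
  refine ⟨⟨t, fun x y => ?_⟩, ?_⟩
  · obtain ⟨a, rfl⟩ := (S.hatEquiv hL hE hv).surjective x
    obtain ⟨a', rfl⟩ := (S.hatEquiv hL hE hv).surjective y
    rw [hatEquiv_apply, hatEquiv_apply, ht, ht, hN]
  · refine S.hat_injective hL hw.1 (S.congr_mem_indecomposable (one_mem _) t hv).1 fun a => ?_
    rw [← ht]
    exact (S.hat_congr_one t v a).symm

lemma phi_congr_OE (ψ : AddChar F K) (v : V ⊗[F] E) (t : OE F E) (u : S.Sp) :
    S.phi ψ (TensorProduct.congr (LinearEquiv.refl F V) t.1 v) u = S.phi ψ v u := by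
  have h1 : TensorProduct.congr u.1 (LinearEquiv.refl F E)
      (TensorProduct.congr (LinearEquiv.refl F V) t.1 v) =
      TensorProduct.congr (LinearEquiv.refl F V) t.1
      (TensorProduct.congr u.1 (LinearEquiv.refl F E) v) := by
    have : (TensorProduct.congr u.1 (LinearEquiv.refl F E)).toLinearMap ∘ₗ
      (TensorProduct.congr (LinearEquiv.refl F V) t.1).toLinearMap =
      (TensorProduct.congr (LinearEquiv.refl F V) t.1).toLinearMap ∘ₗ
      (TensorProduct.congr u.1 (LinearEquiv.refl F E)).toLinearMap := by
      ext x e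
      rfl
    exact LinearMap.congr_fun this v
  have h3 : (S.form.tmul (normForm F E)).compl₁₂
      (TensorProduct.congr (LinearEquiv.refl F V) t.1).toLinearMap
      (TensorProduct.congr (LinearEquiv.refl F V) t.1).toLinearMap =
      S.form.tmul (normForm F E) := by
    ext x e y f
    simp [t.2 e f]
  have h4 := LinearMap.congr_fun₂ h3 (TensorProduct.congr u.1 (LinearEquiv.refl F E) v - v) v
  rw [LinearMap.compl₁₂_apply, LinearEquiv.coe_coe, map_sub] at h4
  rw [phi, phi, h1, h4]

/-! ### The stabilizer of an orbit of indecomposable vectors -/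

lemma congr_congr (g g' : V ≃ₗ[F] V) (t t' : E ≃ₗ[F] E) (v : V ⊗[F] E) :
    TensorProduct.congr g t (TensorProduct.congr g' t' v) =
      TensorProduct.congr (g * g') (t * t') v := by
  rw [TensorProduct.congr_mul]
  rfl

/-- An element of the Levi subgroup stabilizes the orbit of `v` as soon as it maps `v` into it. -/
lemma mem_orbitStabilizer_iff {v : V ⊗[F] E} {g : S.Sp} :
    g ∈ S.orbitStabilizer v ↔ g ∈ S.levi ∧ ∃ t : OE F E, TensorProduct.congr g.1 t.1 v = v := by
  refine ⟨fun hg => ⟨hg.1, ?_⟩, fun ⟨hg, t, ht⟩ => ⟨hg, ?_⟩⟩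
  · have h1 : TensorProduct.congr g.1 (LinearEquiv.refl F E) v ∈ orbitOE v := by
      rw [← hg.2]
      refine ⟨v, ⟨1, ?_⟩, rfl⟩
      change v = TensorProduct.congr (LinearEquiv.refl F V) (LinearEquiv.refl F E) v
      rw [TensorProduct.congr_refl_refl]
      rfl
    obtain ⟨s, hs⟩ := h1
    refine ⟨s⁻¹, ?_⟩
    have h3 := congrArg (TensorProduct.congr (LinearEquiv.refl F V) s.1⁻¹) hs
    rw [congr_congr, congr_congr, inv_mul_cancel] at h3
    refine h3.trans ?_
    change TensorProduct.congr (LinearEquiv.refl F V) (LinearEquiv.refl F E) v = v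
    rw [TensorProduct.congr_refl_refl]
    rfl
  · have h1 : ∀ s : E ≃ₗ[F] E, TensorProduct.congr g.1 (LinearEquiv.refl F E)
        (TensorProduct.congr (LinearEquiv.refl F V) (s * t.1) v) =
        TensorProduct.congr (LinearEquiv.refl F V) s v := by
      intro s
      conv_rhs => rw [← ht]
      rw [congr_congr, congr_congr]
      rfl
    ext w
    constructor
    · rintro ⟨_, ⟨s, rfl⟩, rfl⟩
      refine ⟨s * t⁻¹, ?_⟩
      have h3 := h1 (s * t⁻¹).1
      have e : (s * t⁻¹).1 * t.1 = s.1 := by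
        change s.1 * t.1⁻¹ * t.1 = s.1
        simp
      rwa [e] at h3
    · rintro ⟨s, rfl⟩
      exact ⟨_, ⟨s * t, rfl⟩, h1 s.1⟩

/-- The element of the Levi subgroup that acts on an indecomposable vector `v` as `t⁻¹`. -/
def iotaFun {v : V ⊗[F] E} (hv : v ∈ S.indecomposable E) (t : OE F E) : S.Sp :=
  S.leviOf ((S.hatEquiv hL hE hv).symm.autConj t.1)

lemma congr_iotaFun {v : V ⊗[F] E} (hv : v ∈ S.indecomposable E) (t : OE F E) :
    TensorProduct.congr (S.iotaFun hL hE hv t).1 t.1 v = v := by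
  have hm : S.iotaFun hL hE hv t ∈ S.levi := S.leviOf_mem _
  refine S.hat_injective hL (S.congr_mem_indecomposable hm _ hv).1 hv.1 fun a => ?_
  obtain ⟨a, rfl⟩ := (S.restrictL _ (S.levi_le hm)).surjective a
  rw [hat_congr]
  have e : S.restrictL (S.iotaFun hL hE hv t) (S.levi_le hm) a =
      (S.hatEquiv hL hE hv).symm.autConj t.1 a := by
    apply Subtype.ext
    rw [coe_restrictL]
    exact S.leviOf_apply_L _ a
  rw [e, ← S.hatEquiv_apply hL hE hv, ← S.hatEquiv_apply hL hE hv]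
  simp [LinearEquiv.autConj]

lemma eq_iotaFun {v : V ⊗[F] E} (hv : v ∈ S.indecomposable E) {t : OE F E} {g : S.Sp}
    (hg : g ∈ S.levi) (h : TensorProduct.congr g.1 t.1 v = v) : g = S.iotaFun hL hE hv t := by
  have hm : S.iotaFun hL hE hv t ∈ S.levi := S.leviOf_mem _
  refine S.levi_ext hg hm fun a ha => ?_
  have h1 := S.hat_congr (S.levi_le hg) t.1 v ⟨a, ha⟩
  have h3 := S.hat_congr (S.levi_le hm) t.1 v ⟨a, ha⟩
  rw [h] at h1
  rw [congr_iotaFun, ← h1] at h3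
  exact congrArg Subtype.val ((S.hat_injective_of_indecomposable hL hv) h3.symm)

lemma iotaFun_injective {v : V ⊗[F] E} (hv : v ∈ S.indecomposable E) :
    Function.Injective (S.iotaFun hL hE hv) := by
  intro s t h
  have h1 := S.congr_iotaFun hL hE hv s
  have h3 := S.congr_iotaFun hL hE hv t
  rw [h] at h1
  set g := S.iotaFun hL hE hv t
  have e : ∀ s : OE F E, TensorProduct.congr g.1 s.1 v = v →
      TensorProduct.congr (LinearEquiv.refl F V) s.1 v =
      TensorProduct.congr g.1⁻¹ (LinearEquiv.refl F E) v := by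
    intro s hs
    conv_rhs => rw [← hs]
    rw [congr_congr, inv_mul_cancel]
    rfl
  exact Subtype.ext (S.eq_of_congr_eq hL hE hv ((e s h1).trans (e t h3).symm))

/-- The isomorphism of `O(E)` with the stabilizer of the orbit of an indecomposable vector. -/
def iota {v : V ⊗[F] E} (hv : v ∈ S.indecomposable E) : OE F E ≃* S.orbitStabilizer v :=
  MulEquiv.ofBijective
    (MonoidHom.mk' (fun t => ⟨S.iotaFun hL hE hv t,
      S.mem_orbitStabilizer_iff.2 ⟨S.leviOf_mem _, t, S.congr_iotaFun hL hE hv t⟩⟩)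
      fun s t => by
        apply Subtype.ext
        change S.leviOf _ = S.leviOf _ * S.leviOf _
        rw [← leviOf_mul, ← map_mul]
        rfl)
    ⟨fun s t h => S.iotaFun_injective hL hE hv (congrArg Subtype.val h), fun g => by
      obtain ⟨hg, t, ht⟩ := S.mem_orbitStabilizer_iff.1 g.2
      exact ⟨t, Subtype.ext (S.eq_iotaFun hL hE hv hg ht).symm⟩⟩

lemma congr_iota {v : V ⊗[F] E} (hv : v ∈ S.indecomposable E) (t : OE F E) :
    TensorProduct.congr (S.iota hL hE hv t).1.1 t.1 v = v := S.congr_iotaFun hL hE hv t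

end Hat

end PolarizedSymplecticSpace

namespace PolarizedSymplecticSpace

section Minus

variable {F E V K : Type*} [Field F] [Fintype F] [Field E] [Algebra F E] [FiniteDimensional F E]
  [AddCommGroup V] [Module F V] [FiniteDimensional F V] [Field K] [CharZero K]
  (S : PolarizedSymplecticSpace F V) (ψ : AddChar F K)
  (h2 : (2 : F) ≠ 0) (hE : Module.finrank F E = 2) (hψ : ψ ≠ 1)

/-! ### The functions in `W₁⁻` -/

/-- The action of `M₁ × O(E)` on `L' ⊗ E`. -/
def act (p : S.levi × OE F E) (w : (S.tensor (E := E) h2 hE).L') :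
    (S.tensor (E := E) h2 hE).L' :=
  ⟨TensorProduct.congr p.1.1.1 p.2.1 w,
    congr_mem_tensorSubspace p.2.1 (fun _ hx => S.apply_mem_L' p.1.2 hx) w.2⟩

lemma coe_act (p : S.levi × OE F E) (w : (S.tensor (E := E) h2 hE).L') :
    (S.act h2 hE p w : V ⊗[F] E) = TensorProduct.congr p.1.1.1 p.2.1 w := rfl

lemma act_act (p p' : S.levi × OE F E) (w : (S.tensor (E := E) h2 hE).L') :
    S.act h2 hE p (S.act h2 hE p' w) = S.act h2 hE (p * p') w :=
  Subtype.ext (congr_congr _ _ _ _ _)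

lemma act_one (w : (S.tensor (E := E) h2 hE).L') : S.act h2 hE 1 w = w := by
  apply Subtype.ext
  change TensorProduct.congr (LinearEquiv.refl F V) (LinearEquiv.refl F E) (w : V ⊗[F] E) = w
  rw [TensorProduct.congr_refl_refl]
  rfl

lemma act_act_inv (p : S.levi × OE F E) (w : (S.tensor (E := E) h2 hE).L') :
    S.act h2 hE p (S.act h2 hE p⁻¹ w) = w := by
  rw [act_act, mul_inv_cancel, act_one]

lemma act_inv_act (p : S.levi × OE F E) (w : (S.tensor (E := E) h2 hE).L') :
    S.act h2 hE p⁻¹ (S.act h2 hE p w) = w := by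
  rw [act_act, inv_mul_cancel, act_one]

lemma act_eq_iff (p : S.levi × OE F E) (w w' : (S.tensor (E := E) h2 hE).L') :
    S.act h2 hE p w = w' ↔ w = S.act h2 hE p⁻¹ w' := by
  constructor
  · rintro rfl
    rw [act_inv_act]
  · rintro rfl
    rw [act_act_inv]

lemma isWeil_tensor [Finite (V ⊗[F] E)] :
    (S.tensor h2 hE).IsWeil ψ ((S.tensor (E := E) h2 hE).weilRep ψ h2 hψ) :=
  (S.tensor h2 hE).isWeil_weilRep ψ h2 hψ

/-- The scalar by which the Weil representation differs from the geometric action of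
`M₁ × O(E)`. -/
def pairScalar (p : S.Sp × OE F E) : K :=
  have : Finite (V ⊗[F] E) := Module.finite_of_finite F
  (S.tensor h2 hE).weilScalar ((S.tensor (E := E) h2 hE).weilRep ψ h2 hψ) (S.dualPair h2 hE p)

lemma weilPair_act (p : S.levi × OE F E) (f : (S.tensor (E := E) h2 hE).L' → K)
    (w : (S.tensor (E := E) h2 hE).L') :
    S.weilPair ψ h2 hE hψ (p.1, p.2) f (S.act h2 hE p w) =
      S.pairScalar ψ h2 hE hψ (p.1, p.2) * f w := by
  have : Finite (V ⊗[F] E) := Module.finite_of_finite F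
  have h := (S.tensor h2 hE).weil_apply hψ (S.isWeil_tensor ψ h2 hE hψ)
    (S.dualPair_mem_siegelParabolic h2 hE (S.levi_le p.1.2) p.2) h2 f w
  have hw : (S.dualPair h2 hE ((p.1 : S.Sp), p.2)).1 w = S.act h2 hE p w := rfl
  rw [hw, snd_L', fst_L'] at h
  simp only [Submodule.coe_zero, map_zero, LinearMap.zero_apply, mul_zero,
    AddChar.map_zero_eq_one, mul_one] at h
  exact h

lemma pairScalar_OE (hL : Module.finrank F S.L = 2) (t : OE F E) :
    S.pairScalar ψ h2 hE hψ (1, t) = 1 := by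
  have : Finite (V ⊗[F] E) := Module.finite_of_finite F
  exact S.weilScalar_OE h2 hE hψ (S.isWeil_tensor ψ h2 hE hψ) hL t

lemma weilPair_OE (hL : Module.finrank F S.L = 2) (t : OE F E)
    (f : (S.tensor (E := E) h2 hE).L' → K) (w : (S.tensor (E := E) h2 hE).L') :
    S.weilPair ψ h2 hE hψ (1, t) f (S.act h2 hE (1, t) w) = f w := by
  have := S.weilPair_act ψ h2 hE hψ (1, t) f w
  rw [OneMemClass.coe_one, S.pairScalar_OE ψ h2 hE hψ hL, one_mul] at this
  exact this

lemma pairScalar_levi_ne_zero (m : S.levi) : S.pairScalar ψ h2 hE hψ (m, 1) ≠ 0 := by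
  intro h
  have h1 := S.weilPair_act ψ h2 hE hψ (m, 1)
    (S.weilPair ψ h2 hE hψ ((m : S.Sp), (1 : OE F E))⁻¹ (fun _ => 1)) 0
  rw [h, zero_mul, ← Module.End.mul_apply, ← map_mul, mul_inv_cancel, map_one] at h1
  exact one_ne_zero h1

/-- The stabilizer of an orbit, being a copy of `O(E)`, is generated by involutions, so it acts
without scalars. -/
lemma pairScalar_iota (hL : Module.finrank F S.L = 2) {v : V ⊗[F] E}
    (hv : v ∈ S.indecomposable E) (t : OE F E) :
    S.pairScalar ψ h2 hE hψ ((S.iota hL hE hv t : S.Sp), 1) = 1 := by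
  have : Finite (V ⊗[F] E) := Module.finite_of_finite F
  let χ : OE F E →* K := ((S.tensor h2 hE).weilScalarHom hψ (S.isWeil_tensor ψ h2 hE hψ)).comp
    ((((S.dualPair h2 hE).comp (MonoidHom.inl S.Sp (OE F E))).comp
      ((S.orbitStabilizer v).subtype.comp (S.iota hL hE hv).toMonoidHom)).codRestrict _
      fun t => S.dualPair_mem_siegelParabolic h2 hE
        (S.levi_le (S.mem_orbitStabilizer_iff.1 (S.iota hL hE hv t).2).1) 1)
  refine map_OE_eq_one h2 hE χ (fun t ht => ?_) t
  refine S.weilScalar_levi_involution h2 hE hψ (S.isWeil_tensor ψ h2 hE hψ)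
    (S.mem_orbitStabilizer_iff.1 (S.iota hL hE hv t).2).1 ?_
  rw [← map_mul, ht, map_one]

lemma dualPair_mem_unipotentRadical {u : S.Sp} (hu : u ∈ S.unipotentRadical) :
    S.dualPair h2 hE (u, (1 : OE F E)) ∈ (S.tensor (E := E) h2 hE).unipotentRadical := by
  rintro _ ⟨y, rfl⟩
  have : (TensorProduct.congr u.1 (LinearEquiv.refl F E)).toLinearMap ∘ₗ S.L.subtype.rTensor E =
      S.L.subtype.rTensor E := by
    ext x e
    change u.1 x ⊗ₜ[F] e = (x : V) ⊗ₜ[F] e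
    rw [hu x x.2]
  exact LinearMap.congr_fun this y

/-- The group `U₁` acts through the characters `phi`. -/
lemma weilPair_unipotent {u : S.Sp} (hu : u ∈ S.unipotentRadical)
    (f : (S.tensor (E := E) h2 hE).L' → K) (w : (S.tensor (E := E) h2 hE).L') :
    S.weilPair ψ h2 hE hψ (u, 1) f w = S.phi ψ (w : V ⊗[F] E) u * f w := by
  have : Finite (V ⊗[F] E) := Module.finite_of_finite F
  have hD := S.dualPair_mem_unipotentRadical h2 hE hu
  have h := (S.tensor h2 hE).weil_apply hψ (S.isWeil_tensor ψ h2 hE hψ)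
    ((S.tensor h2 hE).unipotentRadical_le hD) h2 f w
  have hmem := (S.tensor h2 hE).apply_sub_mem_L hD w
  set w' := (S.dualPair h2 hE (u, (1 : OE F E))).1 w with hw'
  have e : w' = (w' - w) + (w : V ⊗[F] E) := by abel
  have e1 : (S.tensor h2 hE).snd w' = w := by
    rw [e, map_add, ((S.tensor h2 hE).snd_eq_zero_iff _).2 hmem, snd_L', zero_add]
  have e2 : ((S.tensor h2 hE).fst w' : V ⊗[F] E) = w' - w := by
    conv_lhs => rw [e]
    rw [map_add, (S.tensor h2 hE).fst_of_mem hmem, fst_L', add_zero]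
  rw [e1, e2, S.weilScalar_unipotentRadical h2 hE hψ (S.isWeil_tensor ψ h2 hE hψ) hu, one_mul] at h
  exact h

variable {ψ} in
lemma phi_mul (v : (S.tensor (E := E) h2 hE).L') {u u' : S.Sp} (hu : u ∈ S.unipotentRadical)
    (hu' : u' ∈ S.unipotentRadical) :
    S.phi ψ (v : V ⊗[F] E) (u * u') = S.phi ψ (v : V ⊗[F] E) u * S.phi ψ (v : V ⊗[F] E) u' := by
  have hD := S.dualPair_mem_unipotentRadical h2 hE hu
  have hmem := (S.tensor h2 hE).apply_sub_mem_L (S.dualPair_mem_unipotentRadical h2 hE hu') v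
  have e := hD _ hmem
  rw [map_sub] at e
  rw [phi, phi, phi, ← AddChar.map_add_eq_mul, ← mul_add, ← LinearMap.add_apply, ← map_add]
  have h1 : TensorProduct.congr (u * u').1 (LinearEquiv.refl F E) (v : V ⊗[F] E) =
      (S.dualPair h2 hE (u, (1 : OE F E))).1 ((S.dualPair h2 hE (u', (1 : OE F E))).1 v) := by
    rw [dualPair_apply, dualPair_apply, congr_congr]
    rfl
  have h3 : TensorProduct.congr u.1 (LinearEquiv.refl F E) (v : V ⊗[F] E) =
    (S.dualPair h2 hE (u, (1 : OE F E))).1 v := rfl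
  have h4 : TensorProduct.congr u'.1 (LinearEquiv.refl F E) (v : V ⊗[F] E) =
    (S.dualPair h2 hE (u', (1 : OE F E))).1 v := rfl
  rw [h1, h3, h4]
  rw [sub_eq_iff_eq_add] at e
  rw [e]
  congr 4
  abel

lemma phi_one (v : V ⊗[F] E) : S.phi ψ v 1 = 1 := by
  have : TensorProduct.congr (1 : S.Sp).1 (LinearEquiv.refl F E) v = v := by
    change TensorProduct.congr (LinearEquiv.refl F V) (LinearEquiv.refl F E) v = v
    rw [TensorProduct.congr_refl_refl]
    rfl
  rw [phi, this, sub_self]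
  simp

/-- Membership in `W₁⁻` in terms of values: the functions that transform under `O(E)` by the sign
character. -/
lemma mem_W1minus_iff_forall (hL : Module.finrank F S.L = 2)
    (f : (S.tensor (E := E) h2 hE).L' → K) :
    f ∈ (S.W1minus ψ h2 hE hψ).toSubmodule ↔
      ∀ (t : OE F E) (w : (S.tensor (E := E) h2 hE).L'),
        f (S.act h2 hE (1, t) w) = (signOE t : K) * f w := by
  rw [mem_W1minus]
  constructor
  · rintro ⟨hf, hc⟩
    have h1 : ∀ t : OE F E, signOE t = 1 → ∀ w, f (S.act h2 hE (1, t) w) = f w := by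
      intro t ht w
      conv_lhs => rw [← hf t ((signOE_eq_one_iff t).1 ht)]
      exact S.weilPair_OE ψ h2 hE hψ hL t f w
    have h3 : ∀ w, f (S.act h2 hE (1, conjOE hE) w) = - f w := by
      intro w
      have := S.weilPair_OE ψ h2 hE hψ hL (conjOE hE) f w
      change S.weilPair ψ h2 hE hψ (1, conjOE hE) f = -f at hc
      rw [hc, Pi.neg_apply] at this
      rw [← this, neg_neg]
    intro t w
    rcases mul_self_eq_one_iff.1 (signOE_mul_self t) with ht | ht
    · rw [h1 t ht, ht]
      simp
    · have ht' : signOE (t * conjOE hE) = 1 := by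
        rw [signOE_mul h2 hE, ht, signOE_conjOE h2]
        norm_num
      have h4 := h1 _ ht' (S.act h2 hE (1, conjOE hE) w)
      rw [act_act, h3, Prod.mk_mul_mk, mul_assoc, conjOE_mul_self, mul_one, mul_one] at h4
      rw [h4, ht]
      simp
  · intro hf
    have h1 : ∀ t : OE F E, S.weilPair ψ h2 hE hψ (1, t) f = (signOE t : K) • f := by
      intro t
      ext w
      rw [← S.act_act_inv h2 hE (1, t) w, S.weilPair_OE ψ h2 hE hψ hL, Pi.smul_apply, hf,
        smul_eq_mul, ← mul_assoc, ← Int.cast_mul, signOE_mul_self]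
      simp
    refine ⟨fun t ht => ?_, ?_⟩
    · rw [h1, (signOE_eq_one_iff t).2 ht]
      simp
    · change S.weilPair ψ h2 hE hψ (1, conjOE hE) f = -f
      rw [h1, signOE_conjOE h2]
      simp

/-- The functions in `W₁⁻` vanish on decomposable vectors, which are fixed by a reflection. -/
lemma apply_eq_zero_of_not_indecomposable (hL : Module.finrank F S.L = 2)
    {f : (S.tensor (E := E) h2 hE).L' → K} (hf : f ∈ (S.W1minus ψ h2 hE hψ).toSubmodule)
    {w : (S.tensor (E := E) h2 hE).L'} (hw : (w : V ⊗[F] E) ∉ S.indecomposable E) : f w = 0 := by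
  have : ∃ x ∈ S.L', ∃ e : E, (w : V ⊗[F] E) = x ⊗ₜ e := by
    by_contra! h
    exact hw ⟨w.2, h⟩
  obtain ⟨x, hx, e, he⟩ := this
  obtain ⟨t, hte, ht⟩ := exists_reflection_fixing h2 hE e
  have h1 := (S.mem_W1minus_iff_forall ψ h2 hE hψ hL f).1 hf t w
  have h3 : S.act h2 hE (1, t) w = w := by
    apply Subtype.ext
    rw [coe_act, he]
    change x ⊗ₜ[F] t.1 e = _
    rw [hte]
  rw [h3, ht] at h1
  have h4 : (2 : K) * f w = 0 := by
    push_cast at h1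
    linear_combination h1
  exact (mul_eq_zero.1 h4).resolve_left two_ne_zero

instance fintypeOE : Fintype (OE F E) :=
  have : Finite E := Module.finite_of_finite F
  have : Finite (E ≃ₗ[F] E) := DFunLike.finite _
  Fintype.ofFinite _

open Classical in
/-- The function supported on the `O(E)`-orbit of `v` that transforms under `O(E)` by the sign
character (it is zero if `v` is decomposable). -/
def orbitFun (K : Type*) [Field K] (v : (S.tensor (E := E) h2 hE).L') :
    (S.tensor (E := E) h2 hE).L' → K :=
  fun w => ∑ t : OE F E, if S.act h2 hE (1, t) v = w then (signOE t : K) else 0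

lemma orbitFun_act (p : S.levi × OE F E) (v w : (S.tensor (E := E) h2 hE).L') :
    S.orbitFun h2 hE K v (S.act h2 hE p w) =
      (signOE p.2 : K) * S.orbitFun h2 hE K (S.act h2 hE (p.1, 1)⁻¹ v) w := by
  classical
  rw [orbitFun, orbitFun, Finset.mul_sum, ← Equiv.sum_comp (Equiv.mulLeft p.2)]
  refine Finset.sum_congr rfl fun t _ => ?_
  have : S.act h2 hE (1, p.2 * t) v = S.act h2 hE p w ↔
      S.act h2 hE (1, t) (S.act h2 hE (p.1, 1)⁻¹ v) = w := by
    rw [eq_comm, act_eq_iff, act_act, act_act, eq_comm]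
    have : p⁻¹ * (1, p.2 * t) = (1, t) * (p.1, 1)⁻¹ := by
      ext1 <;> simp
    rw [this]
  simp only [Equiv.coe_mulLeft, this, signOE_mul h2 hE, Int.cast_mul]
  split_ifs <;> simp

lemma orbitFun_mem (hL : Module.finrank F S.L = 2) (v : (S.tensor (E := E) h2 hE).L') :
    S.orbitFun h2 hE K v ∈ (S.W1minus ψ h2 hE hψ).toSubmodule := by
  rw [S.mem_W1minus_iff_forall ψ h2 hE hψ hL]
  intro t w
  rw [orbitFun_act]
  have : (((1, t) : S.levi × OE F E).1, (1 : OE F E))⁻¹ = 1 := by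
    ext1 <;> simp
  rw [this, act_one]

lemma orbitFun_self (hL : Module.finrank F S.L = 2) {v : (S.tensor (E := E) h2 hE).L'}
    (hv : (v : V ⊗[F] E) ∈ S.indecomposable E) : S.orbitFun h2 hE K v v = 1 := by
  classical
  rw [orbitFun, Finset.sum_eq_single 1]
  · rw [if_pos, signOE_one, Int.cast_one]
    exact S.act_one h2 hE v
  · intro t _ ht
    rw [if_neg]
    intro h
    apply ht
    apply Subtype.ext
    refine S.eq_of_congr_eq hL hE hv ?_
    exact congrArg Subtype.val (h.trans (S.act_one h2 hE v).symm)
  · simp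

lemma exists_act_eq_of_orbitFun_ne_zero {v w : (S.tensor (E := E) h2 hE).L'}
    (h : S.orbitFun h2 hE K v w ≠ 0) : ∃ t : OE F E, S.act h2 hE (1, t) v = w := by
  classical
  obtain ⟨t, _, ht⟩ := Finset.exists_ne_zero_of_sum_ne_zero h
  refine ⟨t, ?_⟩
  by_contra hne
  rw [if_neg hne] at ht
  exact ht rfl

/-- `W₁⁻` is spanned by the functions `orbitFun`. -/
lemma card_smul_eq_sum_orbitFun (hL : Module.finrank F S.L = 2)
    [Fintype (S.tensor (E := E) h2 hE).L']
    {f : (S.tensor (E := E) h2 hE).L' → K} (hf : f ∈ (S.W1minus ψ h2 hE hψ).toSubmodule) :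
    (Fintype.card (OE F E) : K) • f = ∑ w, f w • S.orbitFun h2 hE K w := by
  classical
  ext v
  simp only [Finset.sum_apply, Pi.smul_apply, orbitFun, smul_eq_mul, Finset.mul_sum]
  rw [Finset.sum_comm]
  have : ∀ t : OE F E, ∑ w, f w * (if S.act h2 hE (1, t) w = v then (signOE t : K) else 0) =
      f v := by
    intro t
    rw [Finset.sum_eq_single (S.act h2 hE (1, t)⁻¹ v)]
    · rw [act_act_inv, if_pos rfl, mul_comm,
        ← (S.mem_W1minus_iff_forall ψ h2 hE hψ hL f).1 hf, act_act_inv]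
    · intro w _ hw
      rw [if_neg, mul_zero]
      rwa [act_eq_iff]
    · simp
  rw [Finset.sum_congr rfl fun t _ => this t]
  simp

end Minus

end PolarizedSymplecticSpace

namespace PolarizedSymplecticSpace

section Irreducible

variable {F E V K : Type*} [Field F] [Fintype F] [Field E] [Algebra F E] [FiniteDimensional F E]
  [AddCommGroup V] [Module F V] [FiniteDimensional F V] [Field K] [CharZero K]
  (S : PolarizedSymplecticSpace F V) (ψ : AddChar F K)
  (h2 : (2 : F) ≠ 0) (hE : Module.finrank F E = 2) (hψ : ψ ≠ 1)

/-! ### Irreducibility -/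

instance finite_Sp : Finite S.Sp :=
  have : Finite V := Module.finite_of_finite F
  have : Finite (V ≃ₗ[F] V) := DFunLike.finite _
  inferInstance

lemma orbitFun_act_left (t : OE F E) (v w : (S.tensor (E := E) h2 hE).L') :
    S.orbitFun h2 hE K (S.act h2 hE (1, t) v) w = (signOE t : K) * S.orbitFun h2 hE K v w := by
  classical
  rw [orbitFun, orbitFun, Finset.mul_sum]
  conv_rhs => rw [← Equiv.sum_comp (Equiv.mulRight t)]
  refine Finset.sum_congr rfl fun s _ => ?_
  rw [act_act, Prod.mk_mul_mk, one_mul, Equiv.coe_mulRight, signOE_mul h2 hE]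
  split_ifs
  · rw [← Int.cast_mul, mul_left_comm, signOE_mul_self, mul_one]
  · rw [mul_zero]

lemma weilPair_levi_orbitFun (m : S.levi) (v : (S.tensor (E := E) h2 hE).L') :
    S.weilPair ψ h2 hE hψ (m, 1) (S.orbitFun h2 hE K v) =
      S.pairScalar ψ h2 hE hψ (m, 1) • S.orbitFun h2 hE K (S.act h2 hE (m, 1) v) := by
  ext w
  rw [← S.act_act_inv h2 hE (m, 1) w, S.weilPair_act ψ h2 hE hψ (m, 1), Pi.smul_apply,
    S.orbitFun_act h2 hE (m, 1), act_inv_act, signOE_one]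
  simp

lemma weilPair_unipotent_orbitFun {u : S.Sp} (hu : u ∈ S.unipotentRadical)
    (v : (S.tensor (E := E) h2 hE).L') :
    S.weilPair ψ h2 hE hψ (u, 1) (S.orbitFun h2 hE K v) =
      S.phi ψ (v : V ⊗[F] E) u • S.orbitFun h2 hE K v := by
  ext w
  rw [S.weilPair_unipotent ψ h2 hE hψ hu, Pi.smul_apply, smul_eq_mul]
  by_cases h : S.orbitFun h2 hE K v w = 0
  · rw [h, mul_zero, mul_zero]
  · obtain ⟨t, rfl⟩ := S.exists_act_eq_of_orbitFun_ne_zero h2 hE h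
    congr 1
    exact S.phi_congr_OE ψ (v : V ⊗[F] E) t u

/-- The projection to the `phi`-eigenspace of `U₁` attached to an indecomposable vector `v`, on
`W₁⁻`: the eigenspace is the line spanned by `orbitFun v`. -/
lemma sum_phi_inv_smul (hL : Module.finrank F S.L = 2) [Fintype S.unipotentRadical]
    {v : (S.tensor (E := E) h2 hE).L'} (hv : (v : V ⊗[F] E) ∈ S.indecomposable E)
    {f : (S.tensor (E := E) h2 hE).L' → K} (hf : f ∈ (S.W1minus ψ h2 hE hψ).toSubmodule) :
    ∑ u : S.unipotentRadical, S.phi ψ (v : V ⊗[F] E) u⁻¹ • S.weilPair ψ h2 hE hψ (u, 1) f =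
      ((Fintype.card S.unipotentRadical : K) * f v) • S.orbitFun h2 hE K v := by
  ext w
  have hu : ∀ u : S.unipotentRadical, S.weilPair ψ h2 hE hψ (u, 1) f w =
      S.phi ψ (w : V ⊗[F] E) u * f w := fun u => S.weilPair_unipotent ψ h2 hE hψ u.2 f w
  simp only [Finset.sum_apply, Pi.smul_apply, smul_eq_mul, hu]
  have hinv : ∀ u : S.unipotentRadical,
      S.phi ψ (v : V ⊗[F] E) u⁻¹ * S.phi ψ (v : V ⊗[F] E) u = 1 := fun u => by
    rw [← S.phi_mul h2 hE v (inv_mem u.2) u.2, inv_mul_cancel, phi_one]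
  by_cases h : ∃ t : OE F E, S.act h2 hE (1, t) v = w
  · obtain ⟨t, rfl⟩ := h
    have e1 : ∀ u : S.unipotentRadical,
        S.phi ψ (S.act h2 hE (1, t) v : V ⊗[F] E) u = S.phi ψ (v : V ⊗[F] E) u :=
      fun u => S.phi_congr_OE ψ (v : V ⊗[F] E) t u
    rw [(S.mem_W1minus_iff_forall ψ h2 hE hψ hL f).1 hf,
      (S.mem_W1minus_iff_forall ψ h2 hE hψ hL _).1 (S.orbitFun_mem ψ h2 hE hψ hL v),
      S.orbitFun_self h2 hE hL hv]
    simp only [e1, ← mul_assoc, hinv, one_mul]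
    rw [Finset.sum_const, nsmul_eq_mul, Finset.card_univ]
    ring
  · have h0 : S.orbitFun h2 hE K v w = 0 := by
      by_contra h0
      exact h (S.exists_act_eq_of_orbitFun_ne_zero h2 hE h0)
    rw [h0, mul_zero]
    by_cases hw : (w : V ⊗[F] E) ∈ S.indecomposable E
    · let χ : S.unipotentRadical →* K :=
        { toFun := fun u => S.phi ψ (v : V ⊗[F] E) u⁻¹ * S.phi ψ (w : V ⊗[F] E) u
          map_one' := by simp [phi_one]
          map_mul' := fun u u' => by
            rw [Subgroup.coe_mul, mul_inv_rev,
              S.phi_mul h2 hE w u.2 u'.2, S.phi_mul h2 hE v (inv_mem u'.2) (inv_mem u.2)]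
            ring }
      have hχ : χ ≠ 1 := by
        intro h1
        obtain ⟨t, ht⟩ := S.exists_congr_eq_of_phi_eq hL h2 hE hψ hv hw fun u hu => by
          have h3 : S.phi ψ (v : V ⊗[F] E) u⁻¹ * S.phi ψ (w : V ⊗[F] E) u = 1 :=
            DFunLike.congr_fun h1 (⟨u, hu⟩ : S.unipotentRadical)
          have h4 := hinv ⟨u, hu⟩
          have h5 : S.phi ψ (v : V ⊗[F] E) u⁻¹ ≠ 0 := left_ne_zero_of_mul_eq_one h4
          exact mul_left_cancel₀ h5 (h4.trans h3.symm)
        exact h ⟨t, Subtype.ext ht.symm⟩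
      have h1 := sum_hom_units_eq_zero χ hχ
      have h3 : ∀ u : S.unipotentRadical, S.phi ψ (v : V ⊗[F] E) u⁻¹ *
          (S.phi ψ (w : V ⊗[F] E) u * f w) = χ u * f w := fun u => (mul_assoc _ _ _).symm
      rw [Finset.sum_congr rfl fun u _ => h3 u, ← Finset.sum_mul, h1, zero_mul]
    · rw [S.apply_eq_zero_of_not_indecomposable ψ h2 hE hψ hL hf hw]
      simp

/-- `W₁⁻` is generated under `P₁` by any of its nonzero vectors. -/
lemma W1minus_le_of_ne_zero (hL : Module.finrank F S.L = 2)
    {N : Submodule K ((S.tensor (E := E) h2 hE).L' → K)}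
    (hN : ∀ g ∈ S.siegelParabolic, ∀ f ∈ N, S.weilPair ψ h2 hE hψ (g, 1) f ∈ N)
    {f : (S.tensor (E := E) h2 hE).L' → K} (hfN : f ∈ N) (hf0 : f ≠ 0)
    (hf : f ∈ (S.W1minus ψ h2 hE hψ).toSubmodule) :
    (S.W1minus ψ h2 hE hψ).toSubmodule ≤ N := by
  have : Finite (V ⊗[F] E) := Module.finite_of_finite F
  have : Fintype (S.tensor (E := E) h2 hE).L' := Fintype.ofFinite _
  have : Fintype S.unipotentRadical := Fintype.ofFinite _
  obtain ⟨v, hv⟩ := Function.ne_iff.1 hf0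
  have hvi : (v : V ⊗[F] E) ∈ S.indecomposable E := by
    by_contra h
    exact hv (S.apply_eq_zero_of_not_indecomposable ψ h2 hE hψ hL hf h)
  have h1 : S.orbitFun h2 hE K v ∈ N := by
    have h := S.sum_phi_inv_smul ψ h2 hE hψ hL hvi hf
    have hmem : ((Fintype.card S.unipotentRadical : K) * f v) • S.orbitFun h2 hE K v ∈ N := by
      rw [← h]
      exact sum_mem fun u _ => N.smul_mem _ (hN u (S.unipotentRadical_le u.2) f hfN)
    exact (N.smul_mem_iff (mul_ne_zero (Nat.cast_ne_zero.2 Fintype.card_ne_zero) hv)).1 hmem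
  have h3 : ∀ w : (S.tensor (E := E) h2 hE).L', (w : V ⊗[F] E) ∈ S.indecomposable E →
      S.orbitFun h2 hE K w ∈ N := by
    intro w hw
    obtain ⟨m, hm, hmw⟩ := S.exists_levi_congr_eq hL hE hvi hw
    have hw' : S.act h2 hE (⟨m, hm⟩, 1) v = w := Subtype.ext hmw
    have h4 := hN m (S.levi_le hm) _ h1
    have h5 := S.weilPair_levi_orbitFun ψ h2 hE hψ ⟨m, hm⟩ v
    rw [hw'] at h5
    rw [h5] at h4
    exact (N.smul_mem_iff (S.pairScalar_levi_ne_zero ψ h2 hE hψ ⟨m, hm⟩)).1 h4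
  intro f' hf'
  have h4 : (Fintype.card (OE F E) : K) • f' ∈ N := by
    rw [S.card_smul_eq_sum_orbitFun ψ h2 hE hψ hL hf']
    refine sum_mem fun w _ => ?_
    by_cases hw : (w : V ⊗[F] E) ∈ S.indecomposable E
    · exact N.smul_mem _ (h3 w hw)
    · rw [S.apply_eq_zero_of_not_indecomposable ψ h2 hE hψ hL hf' hw, zero_smul]
      exact zero_mem _
  exact (N.smul_mem_iff (Nat.cast_ne_zero.2 Fintype.card_ne_zero)).1 h4

lemma W1minus_ne_bot (hL : Module.finrank F S.L = 2) :
    (S.W1minus ψ h2 hE hψ).toSubmodule ≠ ⊥ := by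
  obtain ⟨v, hv⟩ := S.indecomposable_nonempty (E := E) hL hE
  let v' : (S.tensor (E := E) h2 hE).L' := ⟨v, hv.1⟩
  intro h
  have h1 := S.orbitFun_mem ψ h2 hE hψ hL v'
  rw [h, Submodule.mem_bot] at h1
  have h3 := S.orbitFun_self (K := K) h2 hE hL (v := v') hv
  rw [h1] at h3
  exact zero_ne_one h3

/-- A representation on `W₁⁻` whose operators include those of `P₁` is irreducible. -/
lemma isIrreducible_of_siegelParabolic (hL : Module.finrank F S.L = 2) {G : Type*} [Group G]
    (ρ : Representation K G (S.W1minus ψ h2 hE hψ).toSubmodule)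
    (hρ : ∀ g ∈ S.siegelParabolic, ∃ x : G, ∀ f,
      (ρ x f : (S.tensor (E := E) h2 hE).L' → K) = S.weilPair ψ h2 hE hψ (g, 1) f) :
    ρ.IsIrreducible := by
  have hbt : (⊥ : Subrepresentation ρ) ≠ ⊤ := by
    intro h
    obtain ⟨f, hf, hf0⟩ := Submodule.exists_mem_ne_zero_of_ne_bot (S.W1minus_ne_bot ψ h2 hE hψ hL)
    have h1 : (⟨f, hf⟩ : (S.W1minus ψ h2 hE hψ).toSubmodule) ∈
        (⊥ : Subrepresentation ρ).toSubmodule := by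
      rw [h]
      exact Submodule.mem_top
    exact hf0 (congrArg Subtype.val ((Submodule.mem_bot K).1 h1))
  refine { exists_pair_ne := ⟨⊥, ⊤, hbt⟩, eq_bot_or_eq_top := fun N => ?_ }
  by_cases hN : N.toSubmodule = ⊥
  · exact Or.inl (Subrepresentation.toSubmodule_injective hN)
  · right
    apply Subrepresentation.toSubmodule_injective
    change N.toSubmodule = ⊤
    obtain ⟨f, hf, hf0⟩ := Submodule.exists_mem_ne_zero_of_ne_bot hN
    have key := S.W1minus_le_of_ne_zero ψ h2 hE hψ hL
      (N := N.toSubmodule.map (S.W1minus ψ h2 hE hψ).toSubmodule.subtype) (by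
        rintro g hg _ ⟨f', hf', rfl⟩
        obtain ⟨x, hx⟩ := hρ g hg
        exact ⟨ρ x f', N.apply_mem_toSubmodule x hf', hx f'⟩)
      ⟨f, hf, rfl⟩ (fun h => hf0 (Subtype.ext h)) f.2
    rw [eq_top_iff]
    rintro f' -
    obtain ⟨f'', hf'', h⟩ := key f'.2
    have : f'' = f' := Subtype.ext h
    rwa [← this]

/-! ### The inducing character -/

lemma weilPair_mul_apply (g g' : S.Sp) (f : (S.tensor (E := E) h2 hE).L' → K) :
    S.weilPair ψ h2 hE hψ (g * g', 1) f =
      S.weilPair ψ h2 hE hψ (g, 1) (S.weilPair ψ h2 hE hψ (g', 1) f) := by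
  rw [← Module.End.mul_apply, ← map_mul, Prod.mk_mul_mk, mul_one]

/-- `orbitFun v` spans a line that is stable under `O U₁`. -/
lemma exists_weilPair_orbitFun_eq_smul (v : (S.tensor (E := E) h2 hE).L') {g : S.Sp}
    (hg : g ∈ S.orbitStabilizer (v : V ⊗[F] E) ⊔ S.unipotentRadical) :
    ∃ c : K, S.weilPair ψ h2 hE hψ (g, 1) (S.orbitFun h2 hE K v) = c • S.orbitFun h2 hE K v := by
  rw [Subgroup.sup_eq_closure] at hg
  induction hg using Subgroup.closure_induction with
  | mem g hg =>
    rcases hg with hg | hg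
    · obtain ⟨hm, t, ht⟩ := S.mem_orbitStabilizer_iff.1 hg
      refine ⟨S.pairScalar ψ h2 hE hψ (g, 1) * (signOE t : K), ?_⟩
      rw [mul_smul]
      refine (S.weilPair_levi_orbitFun ψ h2 hE hψ ⟨g, hm⟩ v).trans ?_
      congr 1
      ext w
      have h1 : S.act h2 hE (1, t) (S.act h2 hE (⟨g, hm⟩, 1) v) = v := by
        rw [act_act, Prod.mk_mul_mk, one_mul, mul_one]
        exact Subtype.ext ht
      have h3 := S.orbitFun_act_left h2 hE (K := K) t (S.act h2 hE (⟨g, hm⟩, 1) v) w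
      rw [h1] at h3
      rw [Pi.smul_apply, smul_eq_mul, h3, ← mul_assoc, ← Int.cast_mul, signOE_mul_self,
        Int.cast_one, one_mul]
    · exact ⟨_, S.weilPair_unipotent_orbitFun ψ h2 hE hψ hg v⟩
  | one =>
    refine ⟨1, ?_⟩
    rw [one_smul]
    exact LinearMap.congr_fun (map_one (S.weilPair ψ h2 hE hψ)) _
  | mul g g' _ _ hg hg' =>
    obtain ⟨c, hc⟩ := hg
    obtain ⟨c', hc'⟩ := hg'
    refine ⟨c' * c, ?_⟩
    rw [weilPair_mul_apply, hc', map_smul, hc, mul_smul]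
  | inv g _ hg =>
    obtain ⟨c, hc⟩ := hg
    have h := S.weilPair_mul_apply ψ h2 hE hψ g⁻¹ g (S.orbitFun h2 hE K v)
    rw [inv_mul_cancel, hc, map_smul] at h
    have h1 : S.weilPair ψ h2 hE hψ (1, 1) (S.orbitFun h2 hE K v) = S.orbitFun h2 hE K v :=
      LinearMap.congr_fun (map_one (S.weilPair ψ h2 hE hψ)) _
    rw [h1] at h
    by_cases hc0 : c = 0
    · refine ⟨0, ?_⟩
      rw [hc0, zero_smul] at h
      rw [h, map_zero, smul_zero]
    · exact ⟨c⁻¹, by rw [eq_inv_smul_iff₀ hc0]; exact h.symm⟩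

/-- The elements of `P₁` outside `O U₁` move `orbitFun v` to functions vanishing at `v`. -/
lemma mem_of_weilPair_orbitFun_ne_zero
    (v : (S.tensor (E := E) h2 hE).L') {g : S.Sp} (hg : g ∈ S.siegelParabolic)
    (h : S.weilPair ψ h2 hE hψ (g, 1) (S.orbitFun h2 hE K v) v ≠ 0) :
    g ∈ S.orbitStabilizer (v : V ⊗[F] E) ⊔ S.unipotentRadical := by
  obtain ⟨m, hm, u, hu, rfl⟩ := S.exists_levi_mul_unipotent hg
  -- `m u` maps `orbitFun v` to a multiple of `orbitFun (m v)`
  refine mul_mem (Subgroup.mem_sup_left ?_) (Subgroup.mem_sup_right hu)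
  rw [weilPair_mul_apply, S.weilPair_unipotent_orbitFun ψ h2 hE hψ hu, map_smul] at h
  have h1 := S.weilPair_levi_orbitFun ψ h2 hE hψ ⟨m, hm⟩ v
  rw [h1] at h
  obtain ⟨t, ht⟩ := S.exists_act_eq_of_orbitFun_ne_zero h2 hE (K := K)
    (right_ne_zero_of_mul (right_ne_zero_of_mul h))
  refine S.mem_orbitStabilizer_iff.2 ⟨hm, t, ?_⟩
  rw [act_act, Prod.mk_mul_mk, one_mul, mul_one] at ht
  exact congrArg Subtype.val ht

lemma weilPair_iota_orbitFun (hL : Module.finrank F S.L = 2)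
    {v : (S.tensor (E := E) h2 hE).L'} (hv : (v : V ⊗[F] E) ∈ S.indecomposable E) (t : OE F E) :
    S.weilPair ψ h2 hE hψ (S.iota hL hE hv t, 1) (S.orbitFun h2 hE K v) v = signOE t := by
  have hm := (S.mem_orbitStabilizer_iff.1 (S.iota hL hE hv t).2).1
  have h1 := S.weilPair_act ψ h2 hE hψ (⟨S.iota hL hE hv t, hm⟩, 1) (S.orbitFun h2 hE K v)
    (S.act h2 hE (1, t) v)
  have h3 : S.act h2 hE (⟨S.iota hL hE hv t, hm⟩, 1) (S.act h2 hE (1, t) v) = v := by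
    rw [act_act, Prod.mk_mul_mk, one_mul, mul_one]
    exact Subtype.ext (S.congr_iota hL hE hv t)
  rw [h3, S.pairScalar_iota ψ h2 hE hψ hL hv, one_mul,
    (S.mem_W1minus_iff_forall ψ h2 hE hψ hL _).1 (S.orbitFun_mem ψ h2 hE hψ hL v),
    S.orbitFun_self h2 hE hL hv, mul_one] at h1
  exact h1

/-- The character of `O U₁` on the line spanned by `orbitFun v`. -/
def inducingChar (hL : Module.finrank F S.L = 2)
    {v : (S.tensor (E := E) h2 hE).L'} (hv : (v : V ⊗[F] E) ∈ S.indecomposable E) :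
    S.inducingSubgroup (v : V ⊗[F] E) →* Kˣ :=
  MonoidHom.toHomUnits
    { toFun := fun x => S.weilPair ψ h2 hE hψ (x.1.1, 1) (S.orbitFun h2 hE K v) v
      map_one' := by
        refine Eq.trans ?_ (S.orbitFun_self (K := K) h2 hE hL hv)
        exact congrFun (LinearMap.congr_fun (map_one (S.weilPair ψ h2 hE hψ)) _) v
      map_mul' := fun x y => by
        obtain ⟨c, hc⟩ := S.exists_weilPair_orbitFun_eq_smul ψ h2 hE hψ v x.2
        obtain ⟨d, hd⟩ := S.exists_weilPair_orbitFun_eq_smul ψ h2 hE hψ v y.2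
        have h := S.weilPair_mul_apply ψ h2 hE hψ x.1.1 y.1.1 (S.orbitFun h2 hE K v)
        refine (congrFun h v).trans ?_
        change _ = S.weilPair ψ h2 hE hψ (x.1.1, 1) _ v * S.weilPair ψ h2 hE hψ (y.1.1, 1) _ v
        change S.weilPair ψ h2 hE hψ (x.1.1, 1) _ = _ at hc
        change S.weilPair ψ h2 hE hψ (y.1.1, 1) _ = _ at hd
        rw [hd, map_smul, hc]
        simp only [Pi.smul_apply, smul_eq_mul, S.orbitFun_self (K := K) h2 hE hL hv]
        ring }

lemma coe_inducingChar (hL : Module.finrank F S.L = 2)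
    {v : (S.tensor (E := E) h2 hE).L'} (hv : (v : V ⊗[F] E) ∈ S.indecomposable E)
    (x : S.inducingSubgroup (v : V ⊗[F] E)) :
    (S.inducingChar ψ h2 hE hψ hL hv x : K) =
      S.weilPair ψ h2 hE hψ (x.1.1, 1) (S.orbitFun h2 hE K v) v := rfl

lemma W1minusRes_isIrreducible (hL : Module.finrank F S.L = 2) :
    (S.W1minusRes ψ h2 hE hψ).IsIrreducible :=
  S.isIrreducible_of_siegelParabolic ψ h2 hE hψ hL _ fun g hg => ⟨⟨g, hg⟩, fun _ => rfl⟩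

lemma nonempty_equiv_ind_inducingChar (hL : Module.finrank F S.L = 2)
    {v : (S.tensor (E := E) h2 hE).L'} (hv : (v : V ⊗[F] E) ∈ S.indecomposable E) :
    Nonempty ((S.W1minusRes ψ h2 hE hψ).Equiv
      (Representation.ind (S.inducingSubgroup (v : V ⊗[F] E)).subtype
        (charRep (S.inducingChar ψ h2 hE hψ hL hv)))) := by
  refine Representation.nonempty_equiv_ind _ (S.W1minusRes_isIrreducible ψ h2 hE hψ hL) _ _
    ⟨S.orbitFun h2 hE K v, S.orbitFun_mem ψ h2 hE hψ hL v⟩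
    (LinearMap.proj v ∘ₗ (S.W1minus ψ h2 hE hψ).toSubmodule.subtype)
    (S.orbitFun_self h2 hE hL hv) (fun x => ?_) (fun g hg => ?_)
  · apply Subtype.ext
    obtain ⟨c, hc⟩ := S.exists_weilPair_orbitFun_eq_smul ψ h2 hE hψ v x.2
    have h := S.coe_inducingChar ψ h2 hE hψ hL hv x
    change S.weilPair ψ h2 hE hψ (x.1.1, 1) _ = _ at hc
    rw [hc, Pi.smul_apply, S.orbitFun_self h2 hE hL hv, smul_eq_mul, mul_one] at h
    rw [h]
    exact hc
  · by_contra h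
    exact hg (S.mem_of_weilPair_orbitFun_ne_zero ψ h2 hE hψ v g.2 h)

/-- The restriction of `W₁⁻` to `P₁` is induced from the character by which `O U₁` acts on the line
of `orbitFun v`; evaluating at `v` gives the values of this character. -/
theorem exists_iota_char_equiv_ind (hL : Module.finrank F S.L = 2) {v : V ⊗[F] E}
    (hv : v ∈ S.indecomposable E) :
    ∃ ι : OE F E ≃* S.orbitStabilizer v,
      (∀ t : OE F E, TensorProduct.congr (ι t).1.1 t.1 v = v) ∧
      ∃ φ' : S.inducingSubgroup v →* Kˣ,
        (∀ (x : S.inducingSubgroup v) (t : OE F E), ∀ g ∈ S.unipotentRadical,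
          (x : S.siegelParabolic).1 = (ι t).1 * g →
            (φ' x : K) = (signOE t : K) * S.phi ψ v g) ∧
        Nonempty ((S.W1minusRes ψ h2 hE hψ).Equiv
          (Representation.ind (S.inducingSubgroup v).subtype (charRep φ'))) := by
  obtain ⟨v, rfl⟩ : ∃ v' : (S.tensor (E := E) h2 hE).L', (v' : V ⊗[F] E) = v := ⟨⟨v, hv.1⟩, rfl⟩
  refine ⟨S.iota hL hE hv, S.congr_iota hL hE hv, S.inducingChar ψ h2 hE hψ hL hv, ?_,
    S.nonempty_equiv_ind_inducingChar ψ h2 hE hψ hL hv⟩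
  intro x t g hg hx
  have h1 := S.coe_inducingChar ψ h2 hE hψ hL hv x
  rw [hx, weilPair_mul_apply, S.weilPair_unipotent_orbitFun ψ h2 hE hψ hg, map_smul,
    Pi.smul_apply, smul_eq_mul] at h1
  rw [S.weilPair_iota_orbitFun ψ h2 hE hψ hL hv t, mul_comm] at h1
  exact h1

lemma finrank_L_eq_two (hV : Module.finrank F V = 4) : Module.finrank F S.L = 2 := by
  have h1 := S.finrank_add_finrank
  rw [← S.finrank_L_eq, hV] at h1
  omega

lemma W1minus_isIrreducible (hL : Module.finrank F S.L = 2) :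
    (S.W1minus ψ h2 hE hψ).toRepresentation.IsIrreducible :=
  S.isIrreducible_of_siegelParabolic ψ h2 hE hψ hL _ fun g _ => ⟨g, fun _ => rfl⟩

end Irreducible

end PolarizedSymplecticSpace

end

theorem mainTheorem4
    (l : ℕ) [Fact l.Prime]
    {F E V : Type*} [Field F] [Fintype F] [Field E] [Algebra F E] [FiniteDimensional F E]
    [AddCommGroup V] [Module F V] [FiniteDimensional F V]
    (h2 : (2 : F) ≠ 0) (hl : (l : F) ≠ 0)
    (hE : Module.finrank F E = 2) (hV : Module.finrank F V = 4)
    (S : PolarizedSymplecticSpace F V)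
    (ψ : AddChar F (AlgebraicClosure ℚ_[l])) (hψ : ψ ≠ 1) :
    -- the restriction to `P₁` is irreducible
    (S.W1minusRes ψ h2 hE hψ).IsIrreducible ∧
    -- for every indecomposable `v`, with `O` the stabilizer in `M₁` of its `O(E)`-orbit, the
    -- restriction is induced from `O U₁`
    (S.indecomposable E).Nonempty ∧
    (∀ v ∈ S.indecomposable E,
      ∃ ι : OE F E ≃* S.orbitStabilizer v,
        (∀ t : OE F E, TensorProduct.congr (ι t).1.1 t.1 v = v) ∧
        ∃ φ' : S.inducingSubgroup v →* (AlgebraicClosure ℚ_[l])ˣ,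
          (∀ (x : S.inducingSubgroup v) (t : OE F E), ∀ g ∈ S.unipotentRadical,
            (x : S.siegelParabolic).1 = (ι t).1 * g →
              (φ' x : AlgebraicClosure ℚ_[l]) =
                (signOE t : AlgebraicClosure ℚ_[l]) * S.phi ψ v g) ∧
          Nonempty ((S.W1minusRes ψ h2 hE hψ).Equiv
            (Representation.ind (S.inducingSubgroup v).subtype (charRep φ')))) ∧
    -- hence the representation of `Sp(V)` is irreducible
    (S.W1minus ψ h2 hE hψ).toRepresentation.IsIrreducible := by
  have hL := S.finrank_L_eq_two hV
  exact ⟨S.W1minusRes_isIrreducible ψ h2 hE hψ hL, S.indecomposable_nonempty hL hE,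
    fun _ hv => S.exists_iota_char_equiv_ind ψ h2 hE hψ hL hv,
    S.W1minus_isIrreducible ψ h2 hE hψ hL⟩
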